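/- Conventions. A category is \emph{Barr exact} if it is regular (it has finite limits and coequalizers of kernel pairs, and regular epimorphisms are pullback stable) and every internal equivalence relation is a kernel pair. It is \emph{Bourn protomodular} if it has pullbacks and, for every morphism $p:E\to B$, the pullback functor $p^*:\mathrm{Pt}(B)\to\mathrm{Pt}(E)$ between categories of split epimorphisms with chosen splittings reflects isomorphisms. It is \emph{semi-abelian} if it is Barr exact and Bourn protomodular, has finite coproducts and is pointed (has a zero object). It is \emph{ideally exact} if it is Barr exact and Bourn protomodular, has finite coproducts, and the morphism $0\to1$ from the initial to the terminal object is a regular epimorphism. A \emph{variety} is the category of all algebras (the empty one included if there are no nullary operations) for a set of finitary operations and a set of identities; it is \emph{non-trivial} if some algebra in it has at least two elements. For $n\ge 0$, say that a variety \emph{has $n$-terms} if it has nullary terms $e_1,\dots,e_n$, binary terms $t_1,\dots,t_n$ and an $(n+1)$-ary term $t$ such that the identities $$t(x,t_1(x,y),\dots,t_n(x,y))=y,\qquad t_k(x,x)=e_k\quad(k=1,\dots,n)$$ hold in it. Theorem. (1) A variety is Bourn protomodular if and only if it has $n$-terms for some $n\ge0$. (2) A non-trivial variety is ideally exact if and only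 if it is Bourn protomodular. (3) A variety with $n$-terms is pointed if and only if it is semi-abelian, and in this case $e_1=\dots=e_n$ holds in it. Heyting algebras form a variety with $2$-terms for which $e_1=e_2$; it is ideally exact but not pointed. (4) Every variety that has the operations of loops, or of groups, among its terms (satisfying the loop, respectively group, identities), with arbitrary additional structure, has $1$-terms and is ideally exact. Every variety of groups with multiple operators (a variety with group terms in which $f(e,\dots,e)=e$ for every operation $f$, where $e$ is the neutral element) has $1$-terms and is pointed, semi-abelian and ideally exact. (5) The unital rings form a variety with $1$-terms, which is ideally exact and not pointed. For every commutative unital ring $R$, the unital associative $R$-algebras, and also the unital not necessarily associative $R$-algebras, form a variety with $1$-terms, which is ideally exact and, if $R\neq0$, not pointed. (6) A variety has $0$-terms if and only if all its algebras have at most one element. Such varieties exist both with and without the empty algebra, and two of them are equivalent as categories if and only if both or neither of them contain the empty algebra. All of them are Bourn protomodular, but such a variety is ideally exact if and only if it does not contain the empty algebra. (7) A lattice, viewed as a category, is always Bourn protomodular, and it is Barr exact if it has a greatest element; it is ideally exact if and only if it has exactly one element. -/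

import Mathlib

open CategoryTheory CategoryTheory.Limits

universe u v w

/-! ### Barr exact, Bourn protomodular, semi-abelian and ideally exact categories -/

/-- A category is Barr exact if it is regular (finite limits, coequalizers of kernel pairs,
pullback stable regular epimorphisms) and every internal equivalence relation is a kernel pair. -/
structure BarrExact (C : Type u) [Category.{v} C] : Prop where
  regular : Regular C
  effective : ∀ ⦃R X : C⦄ (p₁ p₂ : R ⟶ X), IsEquivalenceRelation p₁ p₂ →
    ∃ (Y : C) (f : X ⟶ Y), IsKernelPair f p₁ p₂

/-- A point over `B`: a split epimorphism with codomain `B` together with a chosen splitting. -/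
structure Pt {C : Type u} [Category.{v} C] (B : C) where
  obj : C
  proj : obj ⟶ B
  sect : B ⟶ obj
  sect_proj : sect ≫ proj = 𝟙 B

namespace Pt

variable {C : Type u} [Category.{v} C]

/-- Morphisms of points over `B` commute with both the projections and the splittings. -/
@[ext]
structure Hom {B : C} (X Y : Pt B) where
  hom : X.obj ⟶ Y.obj
  hom_proj : hom ≫ Y.proj = X.proj
  sect_hom : X.sect ≫ hom = Y.sect

instance {B : C} : Category (Pt B) where
  Hom X Y := Hom X Y
  id X := ⟨𝟙 X.obj, Category.id_comp _, Category.comp_id _⟩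
  comp f g := ⟨f.hom ≫ g.hom,
    by rw [Category.assoc, g.hom_proj, f.hom_proj],
    by rw [← Category.assoc, f.sect_hom, g.sect_hom]⟩
  id_comp _ := Hom.ext (Category.id_comp _)
  comp_id _ := Hom.ext (Category.comp_id _)
  assoc _ _ _ := Hom.ext (Category.assoc _ _ _)

@[ext]
theorem hom_ext {B : C} {X Y : Pt B} {f g : X ⟶ Y} (h : f.hom = g.hom) : f = g :=
  Hom.ext h

@[simp]
theorem id_hom {B : C} (X : Pt B) : Hom.hom (𝟙 X) = 𝟙 X.obj := rfl

@[simp]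
theorem comp_hom {B : C} {X Y Z : Pt B} (f : X ⟶ Y) (g : Y ⟶ Z) :
    Hom.hom (f ≫ g) = f.hom ≫ g.hom := rfl

/-- The pullback of a point along `p`. -/
noncomputable def pullbackObj [HasPullbacks C] {E B : C} (p : E ⟶ B) (X : Pt B) : Pt E where
  obj := pullback X.proj p
  proj := pullback.snd X.proj p
  sect := pullback.lift (p ≫ X.sect) (𝟙 E) (by simp [X.sect_proj])
  sect_proj := pullback.lift_snd _ _ _

theorem pullbackMap_aux [HasPullbacks C] {E B : C} (p : E ⟶ B) {X Y : Pt B} (f : X ⟶ Y) :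
    (pullback.fst X.proj p ≫ f.hom) ≫ Y.proj = pullback.snd X.proj p ≫ p := by
  rw [Category.assoc, f.hom_proj, pullback.condition]

theorem pullbackMap_sect [HasPullbacks C] {E B : C} (p : E ⟶ B) {X Y : Pt B} (f : X ⟶ Y) :
    pullback.lift (p ≫ X.sect) (𝟙 E) (by simp [X.sect_proj]) ≫
      pullback.lift (pullback.fst X.proj p ≫ f.hom) (pullback.snd X.proj p)
        (pullbackMap_aux p f) =
    pullback.lift (p ≫ Y.sect) (𝟙 E) (by simp [Y.sect_proj]) := by
  apply pullback.hom_ext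
  · rw [Category.assoc, pullback.lift_fst, pullback.lift_fst, pullback.lift_fst_assoc,
      Category.assoc, f.sect_hom]
  · rw [Category.assoc, pullback.lift_snd, pullback.lift_snd, pullback.lift_snd]

theorem pullbackMap_comp [HasPullbacks C] {E B : C} (p : E ⟶ B) {X Y Z : Pt B} (f : X ⟶ Y)
    (g : Y ⟶ Z) :
    pullback.lift (pullback.fst X.proj p ≫ (f ≫ g).hom) (pullback.snd X.proj p)
        (pullbackMap_aux p (f ≫ g)) =
      pullback.lift (pullback.fst X.proj p ≫ f.hom) (pullback.snd X.proj p)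
        (pullbackMap_aux p f) ≫
      pullback.lift (pullback.fst Y.proj p ≫ g.hom) (pullback.snd Y.proj p)
        (pullbackMap_aux p g) := by
  apply pullback.hom_ext
  · rw [Category.assoc, pullback.lift_fst, pullback.lift_fst, pullback.lift_fst_assoc,
      Category.assoc, comp_hom]
  · rw [Category.assoc, pullback.lift_snd, pullback.lift_snd, pullback.lift_snd]

/-- The change-of-base functor between categories of points, given by pulling back along `p`. -/
noncomputable def changeOfBase [HasPullbacks C] {E B : C} (p : E ⟶ B) : Pt B ⥤ Pt E where
  obj X := pullbackObj p X
  map {X Y} f :=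
    { hom := pullback.lift (pullback.fst X.proj p ≫ f.hom) (pullback.snd X.proj p)
        (pullbackMap_aux p f)
      hom_proj := pullback.lift_snd _ _ _
      sect_hom := pullbackMap_sect p f }
  map_id X := by
    apply hom_ext
    apply pullback.hom_ext <;> simp [pullbackObj]
  map_comp f g := hom_ext (pullbackMap_comp p f g)

end Pt

/-- A category is Bourn protomodular if it has pullbacks and all change-of-base functors between
its categories of points reflect isomorphisms. -/
def BournProtomodular (C : Type u) [Category.{v} C] : Prop :=
  ∃ _ : HasPullbacks C, ∀ ⦃E B : C⦄ (p : E ⟶ B), (Pt.changeOfBase p).ReflectsIsomorphisms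

/-- Semi-abelian categories: pointed, Barr exact, Bourn protomodular, with finite coproducts. -/
structure SemiAbelian (C : Type u) [Category.{v} C] : Prop where
  pointed : HasZeroObject C
  barrExact : BarrExact C
  protomodular : BournProtomodular C
  hasFiniteCoproducts : HasFiniteCoproducts C

/-- Ideally exact categories: Barr exact, Bourn protomodular, with finite coproducts, and such that
the morphism from the initial to the terminal object is a regular epimorphism. (The initial and the
terminal object exist by the other conditions.) -/
structure IdeallyExact (C : Type u) [Category.{v} C] : Prop where
  barrExact : BarrExact C
  protomodular : BournProtomodular C
  hasFiniteCoproducts : HasFiniteCoproducts C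
  regularEpi : ∀ ⦃I T : C⦄ (hI : IsInitial I), IsTerminal T → IsRegularEpi (hI.to T)

/-! ### Varieties of universal algebras -/

/-- A (presentation of a) variety of universal algebras: a signature of finitary operation symbols
(a language without relation symbols) and a set of identities between terms in countably many
variables. -/
structure Variety where
  lang : FirstOrder.Language.{u, 0}
  algebraic : lang.IsAlgebraic
  identities : Set (lang.Term ℕ × lang.Term ℕ)

namespace Variety

/-- The algebras of a variety; the empty algebra is allowed whenever the signature has no
nullary operation symbols. -/
structure Alg (V : Variety.{u}) where
  carrier : Type u
  [str : V.lang.Structure carrier]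
  sat : ∀ e ∈ V.identities, ∀ x : ℕ → carrier, e.1.realize x = e.2.realize x

attribute [instance] Alg.str

variable (V : Variety.{u})

instance : CoeSort V.Alg (Type u) := ⟨Alg.carrier⟩

/-- Morphisms are the homomorphisms of algebras. -/
@[ext]
structure Hom (A B : V.Alg) where
  hom : FirstOrder.Language.Hom V.lang A.carrier B.carrier

instance : Category V.Alg where
  Hom A B := Variety.Hom V A B
  id A := ⟨FirstOrder.Language.Hom.id V.lang A.carrier⟩
  comp f g := ⟨g.hom.comp f.hom⟩

instance : ConcreteCategory V.Alg
    (fun A B => FirstOrder.Language.Hom V.lang A.carrier B.carrier) where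
  hom f := Variety.Hom.hom f
  ofHom f := ⟨f⟩

/-- Nullary, binary and `(n+1)`-ary terms `e k`, `d k`, `t` with
`t (x, d 1 (x, y), ..., d n (x, y)) = y` and `d k (x, x) = e k` in all algebras of the variety. -/
structure ProtomodularTerms (n : ℕ) where
  e : Fin n → V.lang.Term Empty
  d : Fin n → V.lang.Term (Fin 2)
  t : V.lang.Term (Fin (n + 1))
  t_eq : ∀ (A : V.Alg) (x y : A),
    t.realize (Fin.cons x (fun k => (d k).realize ![x, y]) : Fin (n + 1) → A) = y
  d_eq : ∀ (A : V.Alg) (x : A) (k : Fin n),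
    (d k).realize ![x, x] = (e k).realize (Empty.elim : Empty → A)

/-- The identities `e 1 = ... = e n` hold in the variety. -/
def ProtomodularTerms.ConstantsAgree {V : Variety.{u}} {n : ℕ} (T : V.ProtomodularTerms n) :
    Prop :=
  ∀ (A : V.Alg) (j k : Fin n),
    (T.e j).realize (Empty.elim : Empty → A) = (T.e k).realize (Empty.elim : Empty → A)

/-- Terms making all algebras of the variety loops. -/
structure LoopTerms where
  e : V.lang.Term Empty
  mul : V.lang.Term (Fin 2)
  ldiv : V.lang.Term (Fin 2)
  rdiv : V.lang.Term (Fin 2)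
  one_mul : ∀ (A : V.Alg) (x : A), mul.realize ![e.realize Empty.elim, x] = x
  mul_one : ∀ (A : V.Alg) (x : A), mul.realize ![x, e.realize Empty.elim] = x
  mul_ldiv : ∀ (A : V.Alg) (x y : A), mul.realize ![x, ldiv.realize ![x, y]] = y
  ldiv_mul : ∀ (A : V.Alg) (x y : A), ldiv.realize ![x, mul.realize ![x, y]] = y
  rdiv_mul : ∀ (A : V.Alg) (x y : A), mul.realize ![rdiv.realize ![y, x], x] = y
  mul_rdiv : ∀ (A : V.Alg) (x y : A), rdiv.realize ![mul.realize ![y, x], x] = y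

/-- Terms making all algebras of the variety groups. -/
structure GroupTerms where
  e : V.lang.Term Empty
  mul : V.lang.Term (Fin 2)
  inv : V.lang.Term (Fin 1)
  one_mul : ∀ (A : V.Alg) (x : A), mul.realize ![e.realize Empty.elim, x] = x
  inv_mul : ∀ (A : V.Alg) (x : A), mul.realize ![inv.realize ![x], x] = e.realize Empty.elim
  assoc : ∀ (A : V.Alg) (x y z : A),
    mul.realize ![mul.realize ![x, y], z] = mul.realize ![x, mul.realize ![y, z]]

/-- Varieties of groups with multiple operators: varieties of groups with additional operations in
which every operation `f` satisfies `f (e, ..., e) = e` for the neutral element `e`. -/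
def IsGroupsWithMultipleOperators : Prop :=
  ∃ G : V.GroupTerms, ∀ (A : V.Alg) (m : ℕ) (f : V.lang.Functions m),
    FirstOrder.Language.Structure.funMap f (fun _ => G.e.realize (Empty.elim : Empty → A)) =
      G.e.realize (Empty.elim : Empty → A)

/-- All algebras of the variety have at most one element. -/
def AtMostOneElement : Prop := ∀ A : V.Alg, Subsingleton A

/-- The empty set is (the carrier of) an algebra of the variety. -/
def ContainsEmpty : Prop := ∃ A : V.Alg, IsEmpty A

/-- A category with a set-valued functor `U` "is" the variety `V` if it is equivalent to the
category of algebras of `V`, compatibly with the underlying sets. -/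
def Presents {C : Type v} [Category.{w} C] (U : C ⥤ Type u) : Prop :=
  ∃ F : C ⥤ V.Alg, F.IsEquivalence ∧ Nonempty (F ⋙ forget V.Alg ≅ U)

end Variety

/-! ### Unital, not necessarily associative algebras -/

/-- Unital, not necessarily associative algebras over `R`: modules with a bilinear multiplication
that has a two-sided unit. -/
structure NonAssocAlgCat (R : Type u) [CommRing R] where
  carrier : Type u
  [ring : NonAssocRing carrier]
  [module : Module R carrier]
  [isScalarTower : IsScalarTower R carrier carrier]
  [smulCommClass : SMulCommClass R carrier carrier]

namespace NonAssocAlgCat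

variable {R : Type u} [CommRing R]

attribute [instance] ring module isScalarTower smulCommClass

/-- Linear maps that preserve the multiplication and the unit. -/
structure AlgMap (A B : NonAssocAlgCat R) extends A.carrier →ₗ[R] B.carrier where
  map_one' : toFun 1 = 1
  map_mul' : ∀ x y, toFun (x * y) = toFun x * toFun y

instance (A B : NonAssocAlgCat R) : FunLike (AlgMap A B) A.carrier B.carrier where
  coe f := f.toFun
  coe_injective f g h := by
    cases f; cases g; congr; exact DFunLike.coe_injective h

@[ext]
structure Hom (A B : NonAssocAlgCat R) where
  hom : AlgMap A B

instance : Category (NonAssocAlgCat R) where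
  Hom A B := Hom A B
  id A := ⟨{ (LinearMap.id : A.carrier →ₗ[R] A.carrier) with
    map_one' := rfl
    map_mul' := fun _ _ => rfl }⟩
  comp f g := ⟨{ g.hom.toLinearMap.comp f.hom.toLinearMap with
    map_one' := (congrArg g.hom.toFun f.hom.map_one').trans g.hom.map_one'
    map_mul' := fun x y =>
      (congrArg g.hom.toFun (f.hom.map_mul' x y)).trans (g.hom.map_mul' _ _) }⟩

instance : ConcreteCategory (NonAssocAlgCat R) AlgMap where
  hom f := Hom.hom f
  ofHom f := ⟨f⟩

end NonAssocAlgCat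

/-! In a variety the categorical notions become statements about elements: finite limits are
algebras of compatible families, colimits are algebras presented by generators and relations,
regular epimorphisms are the surjective homomorphisms, and internal equivalence relations are
congruences. Hence every variety is Barr exact with finite coproducts, and it is ideally exact
exactly when it is protomodular and its initial algebra is nonempty (`barrExact_alg`,
`ideallyExact_iff`).

From protomodularity to terms: let F(x, y) → F(x) identify the generators, split by x ↦ x, let E be
the algebra of constants in F(x) and K its inverse image in F(x, y). The subalgebra generated by x
and K carries a point over F(x) with the same pullback K along E → F(x), so it is all of F(x, y).
Thus y = t(x, k₁, …, kₙ) with kᵢ = dᵢ(x, y) in K, and dᵢ(x, x) is a constant eᵢ. E and K may be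
empty, in which case n = 0.

From terms to protomodularity: constants lie in the image of every homomorphism p, so a morphism of
points that becomes invertible after pulling back along p is bijective on the fibres over constants.
The differences dᵢ carry injectivity and surjectivity to these fibres, and t brings them back.

If n ≥ 1, a constant excludes the empty algebra; if n = 0, the identity t(x) = y leaves at most one
element. The concrete examples follow by presenting each category as a variety with explicit terms
and transporting ideal exactness along the equivalence. In a lattice all parallel morphisms are
equal, which trivializes most of the conditions. -/

namespace Variety

open FirstOrder.Language FirstOrder.Language.Structure

variable {V : Variety.{u}}

/-! ### Homomorphisms -/

/-- A function that commutes with all operations is a morphism of algebras. -/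
def homMk {A B : V.Alg} (g : A → B)
    (hg : ∀ (n : ℕ) (f : V.lang.Functions n) (x : Fin n → A),
      g (funMap f x) = funMap f (fun i => g (x i))) : A ⟶ B :=
  ⟨{ toFun := g
     map_fun' := fun f x => hg _ f x
     map_rel' := fun r => ((V.algebraic _).false r).elim }⟩

theorem hom_map_fun {A B : V.Alg} (g : A ⟶ B) {n : ℕ} (f : V.lang.Functions n) (x : Fin n → A) :
    g (funMap f x) = funMap f (fun i => g (x i)) :=
  FirstOrder.Language.HomClass.map_fun (Variety.Hom.hom g) f x

theorem hom_realize {A B : V.Alg} (g : A ⟶ B) {α : Type*} (t : V.lang.Term α) (x : α → A) :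
    g (t.realize x) = t.realize (fun i => g (x i)) :=
  (FirstOrder.Language.HomClass.realize_term (Variety.Hom.hom g)).symm

theorem alg_hom_ext {A B : V.Alg} {f g : A ⟶ B} (h : ∀ a, f a = g a) : f = g :=
  ConcreteCategory.hom_ext _ _ h

theorem hom_realize₂ {A B : V.Alg} (g : A ⟶ B) (t : V.lang.Term (Fin 2)) (x y : A) :
    g (t.realize ![x, y]) = t.realize ![g x, g y] := by
  rw [hom_realize]
  congr 1
  ext i
  fin_cases i <;> rfl

theorem hom_realize_const {A B : V.Alg} (g : A ⟶ B) (t : V.lang.Term Empty) :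
    g (t.realize (Empty.elim : Empty → A)) = t.realize (Empty.elim : Empty → B) := by
  rw [hom_realize]
  congr 1
  ext i
  exact i.elim

theorem isIso_of_bijective {A B : V.Alg} (f : A ⟶ B) (hf : Function.Bijective f) : IsIso f := by
  let e := Equiv.ofBijective f hf
  refine ⟨⟨homMk e.symm fun n φ x => ?_, ?_, ?_⟩⟩
  · rw [Equiv.symm_apply_eq]
    change _ = f _
    rw [hom_map_fun]
    congr 1
    ext i
    exact (e.apply_symm_apply (x i)).symm
  · exact alg_hom_ext fun a => e.symm_apply_apply a
  · exact alg_hom_ext fun a => e.apply_symm_apply a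

theorem bijective_of_isIso {A B : V.Alg} (f : A ⟶ B) [IsIso f] : Function.Bijective f := by
  refine Function.bijective_iff_has_inverse.2 ⟨inv f, fun a => ?_, fun b => ?_⟩
  · rw [← ConcreteCategory.comp_apply, IsIso.hom_inv_id, ConcreteCategory.id_apply]
  · rw [← ConcreteCategory.comp_apply, IsIso.inv_hom_id, ConcreteCategory.id_apply]

/-- A morphism that is constant on the fibres of a surjective morphism factors through it. -/
theorem exists_desc_of_surjective {A B C : V.Alg} (f : A ⟶ B) (hf : Function.Surjective f)
    (k : A ⟶ C) (hk : ∀ a a', f a = f a' → k a = k a') : ∃ g : B ⟶ C, f ≫ g = k := by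
  refine ⟨homMk (fun b => k (Function.surjInv hf b)) fun n φ x => ?_, ?_⟩
  · rw [← hom_map_fun]
    apply hk
    rw [hom_map_fun, Function.surjInv_eq hf]
    congr 1
    ext i
    exact (Function.surjInv_eq hf (x i)).symm
  · exact alg_hom_ext fun a => hk _ _ (Function.surjInv_eq hf (f a))

/-! ### Terminal algebras, subalgebras, quotient algebras -/

instance punitStructure (L : FirstOrder.Language.{u, 0}) : L.Structure PUnit.{u + 1} where
  funMap _ _ := PUnit.unit
  RelMap _ _ := False

variable (V) in
/-- The algebra with exactly one element. -/
def punitAlg : V.Alg where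
  carrier := PUnit
  sat _ _ _ := Subsingleton.elim _ _

variable (V) in
/-- The algebra with exactly one element is terminal. -/
def punitAlgIsTerminal : IsTerminal V.punitAlg :=
  IsTerminal.ofUniqueHom (fun _ => homMk (fun _ => PUnit.unit) fun _ _ _ => rfl)
    fun _ _ => alg_hom_ext fun _ => rfl

theorem realize_substructure_coe {A : V.Alg} (S : V.lang.Substructure A.carrier) {α : Type*}
    (t : V.lang.Term α) (x : α → S) : ((t.realize x : S) : A) = t.realize (fun i => (x i : A)) :=
  (FirstOrder.Language.HomClass.realize_term S.subtype).symm

/-- A subalgebra as an algebra of its own. -/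
def subAlg {A : V.Alg} (S : V.lang.Substructure A.carrier) : V.Alg where
  carrier := S
  sat e he x := Subtype.ext <| by
    rw [realize_substructure_coe, realize_substructure_coe, A.sat e he]

/-- The inclusion of a subalgebra. -/
def subAlgι {A : V.Alg} (S : V.lang.Substructure A.carrier) : subAlg S ⟶ A :=
  homMk (fun a : S => (a : A)) fun _ _ _ => rfl

/-- Corestriction of a morphism to a subalgebra. -/
def subAlgLift {A B : V.Alg} (S : V.lang.Substructure A.carrier) (f : B ⟶ A)
    (hf : ∀ b, f b ∈ S) : B ⟶ subAlg S :=
  homMk (B := subAlg S) (fun b => (⟨f b, hf b⟩ : S)) fun _ _ _ => Subtype.ext (hom_map_fun f _ _)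

@[simp]
theorem subAlgLift_comp {A B : V.Alg} (S : V.lang.Substructure A.carrier) (f : B ⟶ A)
    (hf : ∀ b, f b ∈ S) : subAlgLift S f hf ≫ subAlgι S = f := rfl

theorem subAlgι_injective {A : V.Alg} (S : V.lang.Substructure A.carrier) :
    Function.Injective (subAlgι S) := Subtype.val_injective

section Quotient

variable {A : V.Alg} (s : Setoid A)
  (hs : ∀ (n : ℕ) (f : V.lang.Functions n) (x y : Fin n → A), (∀ i, s (x i) (y i)) →
    s (funMap f x) (funMap f y))

/-- The operations on the quotient by a congruence. -/
noncomputable abbrev quotientStructure : V.lang.Structure (Quotient s) where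
  funMap f x := Quotient.mk s (funMap f fun i => (x i).out)
  RelMap _ _ := False

include hs in
theorem quotient_funMap {n : ℕ} (f : V.lang.Functions n) (x : Fin n → A) :
    (quotientStructure s).funMap f (fun i => Quotient.mk s (x i)) =
      Quotient.mk s (funMap f x) :=
  Quotient.sound (hs _ f _ _ fun i => Quotient.mk_out (x i))

include hs in
theorem quotient_realize {α : Type*} (t : V.lang.Term α) (x : α → A) :
    let _ := quotientStructure s
    t.realize (fun i => Quotient.mk s (x i)) = Quotient.mk s (t.realize x) := by
  let _ := quotientStructure s
  induction t with
  | var i => rfl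
  | func f ts ih =>
    simp only [Term.realize_func, ih]
    exact quotient_funMap s hs f _

/-- The quotient algebra by a congruence. -/
noncomputable def quotientAlg : V.Alg :=
  letI := quotientStructure s
  { carrier := Quotient s
    sat := fun e he x => by
      obtain ⟨y, rfl⟩ : ∃ y : ℕ → A, (fun i => Quotient.mk s (y i)) = x :=
        ⟨fun i => (x i).out, funext fun i => Quotient.out_eq (x i)⟩
      rw [quotient_realize s hs, quotient_realize s hs, A.sat e he] }

/-- The quotient map to a quotient algebra. -/
noncomputable def quotientAlgπ : A ⟶ quotientAlg s hs :=
  homMk (B := quotientAlg s hs) (Quotient.mk s) fun _ f x => (quotient_funMap s hs f x).symm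

theorem quotientAlgπ_eq_iff (a b : A) : quotientAlgπ s hs a = quotientAlgπ s hs b ↔ s a b :=
  Quotient.eq

end Quotient

/-! ### Algebras presented by generators and an interpretation property -/

section Presented

variable {X : Type u} (P : ∀ C : V.Alg, (X → C) → Prop)

/-- The congruence on terms that identifies two terms if all admissible interpretations do. -/
def presentedSetoid : Setoid (V.lang.Term X) where
  -- The quantifier over all algebras stays in `Prop`, so the quotient of terms remains in `Type u`.
  -- Free algebras and colimits are both instances, for different `P`.
  r s t := ∀ (C : V.Alg) (φ : X → C), P C φ → s.realize φ = t.realize φ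
  iseqv :=
    { refl := fun _ _ _ _ => rfl
      symm := fun h C φ hφ => (h C φ hφ).symm
      trans := fun h₁ h₂ C φ hφ => (h₁ C φ hφ).trans (h₂ C φ hφ) }

/-- The operations on classes of terms. -/
noncomputable abbrev presentedStructure : V.lang.Structure (Quotient (presentedSetoid P)) where
  funMap f x := Quotient.mk _ (Term.func f fun i => (x i).out)
  RelMap _ _ := False

theorem presented_funMap {n : ℕ} (f : V.lang.Functions n) (x : Fin n → V.lang.Term X) :
    (presentedStructure P).funMap f (fun i => Quotient.mk (presentedSetoid P) (x i)) =
      Quotient.mk _ (Term.func f x) := by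
  refine Quotient.sound fun C φ hφ => ?_
  simp only [Term.realize_func]
  congr 1
  ext i
  exact Quotient.mk_out (s := presentedSetoid P) (x i) C φ hφ

theorem presented_realize {α : Type*} (t : V.lang.Term α) (x : α → V.lang.Term X) :
    let _ := presentedStructure P
    t.realize (fun i => Quotient.mk (presentedSetoid P) (x i)) =
      Quotient.mk (presentedSetoid P) (t.subst x) := by
  let _ := presentedStructure P
  induction t with
  | var i => rfl
  | func f ts ih =>
    simp only [Term.realize_func, ih]
    exact presented_funMap P f _

/-- The algebra generated by `X` in which exactly those equations hold that hold for all
interpretations of `X` with the property `P`. -/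
noncomputable def presentedAlg : V.Alg :=
  letI := presentedStructure P
  { carrier := Quotient (presentedSetoid P)
    sat := fun e he x => by
      obtain ⟨y, rfl⟩ : ∃ y : ℕ → V.lang.Term X,
          (fun i => Quotient.mk (presentedSetoid P) (y i)) = x :=
        ⟨fun i => (x i).out, funext fun i => Quotient.out_eq (x i)⟩
      rw [presented_realize P, presented_realize P]
      refine Quotient.sound fun C φ _ => ?_
      rw [Term.realize_subst, Term.realize_subst, C.sat e he] }

/-- The class of a term in a presented algebra. -/
noncomputable def presentedMk (t : V.lang.Term X) : presentedAlg P := Quotient.mk _ t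

/-- The generators of a presented algebra. -/
noncomputable def presentedVar (x : X) : presentedAlg P := presentedMk P (Term.var x)

theorem presentedMk_eq_iff (s t : V.lang.Term X) : presentedMk P s = presentedMk P t ↔
    ∀ (C : V.Alg) (φ : X → C), P C φ → s.realize φ = t.realize φ :=
  Quotient.eq (r := presentedSetoid P)

theorem presentedMk_surjective : Function.Surjective (presentedMk P) := Quotient.mk_surjective

/-- With `presentedMk_eq_iff`, this makes an equation between terms at the generators equivalent to
its validity under all admissible interpretations. -/
theorem presented_realize_var (t : V.lang.Term X) :
    t.realize (presentedVar P) = presentedMk P t := by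
  refine (presented_realize P t Term.var).trans (congrArg (Quotient.mk _) ?_)
  induction t with
  | var i => rfl
  | func f ts ih => simp only [Term.subst, ih]

/-- The morphism from a presented algebra induced by an admissible interpretation. -/
noncomputable def presentedDesc {C : V.Alg} (φ : X → C) (hφ : P C φ) : presentedAlg P ⟶ C :=
  homMk (A := presentedAlg P)
    (Quotient.lift (fun t : V.lang.Term X => t.realize φ) fun _ _ h => h C φ hφ) fun n f x => by
      obtain ⟨y, rfl⟩ : ∃ y : Fin n → V.lang.Term X,
          (fun i => Quotient.mk (presentedSetoid P) (y i)) = x :=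
        ⟨fun i => (x i).out, funext fun i => Quotient.out_eq (x i)⟩
      exact congrArg (Quotient.lift _ _) (presented_funMap P f y)

theorem presented_hom_ext {C : V.Alg} {f g : presentedAlg P ⟶ C}
    (h : ∀ x, f (presentedVar P x) = g (presentedVar P x)) : f = g := by
  refine alg_hom_ext fun a => ?_
  obtain ⟨t, rfl⟩ := presentedMk_surjective P a
  rw [← presented_realize_var, hom_realize, hom_realize]
  congr 1
  ext x
  exact h x

end Presented

variable (V) in
/-- The free algebra on a set. -/
noncomputable def freeAlg (X : Type u) : V.Alg := presentedAlg (V := V) (X := X) fun _ _ => True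

/-- The generators of a free algebra. -/
noncomputable def freeVar {X : Type u} (x : X) : V.freeAlg X := presentedVar _ x

/-- The morphism from a free algebra given by its values on the generators. -/
noncomputable def freeDesc {X : Type u} {C : V.Alg} (φ : X → C) : V.freeAlg X ⟶ C :=
  presentedDesc _ φ trivial

theorem free_hom_ext {X : Type u} {C : V.Alg} {f g : V.freeAlg X ⟶ C}
    (h : ∀ x, f (freeVar x) = g (freeVar x)) : f = g :=
  presented_hom_ext _ h

/-- The bridge by which an equation found in a free algebra becomes an identity of the variety. -/
theorem realize_freeVar_eq_iff {X : Type u} (s t : V.lang.Term X) :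
    s.realize (freeVar (V := V)) = t.realize (freeVar (V := V)) ↔
      ∀ (C : V.Alg) (φ : X → C), s.realize φ = t.realize φ := by
  refine ((presented_realize_var _ s).congr_left.trans
    (presented_realize_var _ t).congr_right).trans ((presentedMk_eq_iff _ s t).trans ?_)
  simp

theorem exists_realize_freeVar {X : Type u} (a : V.freeAlg X) :
    ∃ t : V.lang.Term X, t.realize freeVar = a := by
  obtain ⟨t, rfl⟩ := presentedMk_surjective _ a
  exact ⟨t, presented_realize_var _ t⟩

/-- The morphism from the free algebra on one generator that picks a given element. -/
noncomputable def elemHom {A : V.Alg} (a : A) : V.freeAlg PUnit ⟶ A := freeDesc fun _ => a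

/-- Elements are morphisms from the free algebra on one generator, naturally in the algebra.
Universal properties can therefore be tested on elements. -/
theorem elemHom_comp {A B : V.Alg} (a : A) (f : A ⟶ B) : elemHom a ≫ f = elemHom (f a) :=
  free_hom_ext fun _ => rfl

theorem elemHom_apply {A : V.Alg} (a : A) : elemHom a (freeVar PUnit.unit) = a := rfl

theorem eq_of_elemHom_eq {A : V.Alg} {a b : A} (h : elemHom a = elemHom b) : a = b :=
  congrArg (fun f : V.freeAlg PUnit ⟶ A => f (freeVar PUnit.unit)) h

end Variety

namespace Variety

open FirstOrder.Language FirstOrder.Language.Structure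

variable {V : Variety.{u}}

/-! ### Limits and colimits of algebras -/

section Limits

variable {J : Type} [SmallCategory J]

/-- The operations on a product of algebras. -/
abbrev piStructure {ι : Type} (A : ι → V.Alg) : V.lang.Structure (∀ j, A j) where
  funMap f x j := funMap f fun i => x i j
  RelMap _ _ := False

theorem pi_realize {ι : Type} (A : ι → V.Alg) {α : Type*} (t : V.lang.Term α)
    (x : α → ∀ j, A j) (j : ι) :
    let _ := piStructure A
    t.realize x j = t.realize fun i => x i j := by
  let _ := piStructure A
  induction t with
  | var i => rfl
  | func f ts ih =>
    simp only [Term.realize_func, ← ih]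
    rfl

/-- The product of algebras. -/
def piAlg {ι : Type} (A : ι → V.Alg) : V.Alg :=
  letI := piStructure A
  { carrier := ∀ j, A j
    sat := fun e he x => funext fun j => by
      rw [pi_realize, pi_realize, (A j).sat e he] }

/-- The compatible families of elements of a diagram of algebras. -/
def sectionsSubstructure (F : J ⥤ V.Alg) : V.lang.Substructure (piAlg F.obj).carrier where
  carrier := {x | ∀ (i j : J) (g : i ⟶ j), F.map g (x i) = x j}
  fun_mem f x hx i j g := by
    refine (hom_map_fun (F.map g) f _).trans ?_
    exact congrArg (funMap f) (funext fun k => hx k i j g)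

/-- The limit cone of compatible families. -/
def sectionsCone (F : J ⥤ V.Alg) : Cone F where
  pt := subAlg (sectionsSubstructure F)
  π :=
    { app := fun j => homMk (A := subAlg (sectionsSubstructure F))
        (fun x : sectionsSubstructure F => x.1 j) fun _ _ _ => rfl
      naturality := fun _ _ g => alg_hom_ext fun x => (x.2 _ _ g).symm }

/-- The cone of compatible families is a limit cone. -/
def sectionsConeIsLimit (F : J ⥤ V.Alg) : IsLimit (sectionsCone F) where
  lift c := homMk (B := subAlg (sectionsSubstructure F))
    (fun a => (⟨fun j => c.π.app j a, fun _ _ g => by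
      rw [← ConcreteCategory.comp_apply, c.w g]⟩ : sectionsSubstructure F))
    fun _ f x => Subtype.ext (funext fun j => hom_map_fun (c.π.app j) f x)
  fac _ _ := rfl
  uniq c m h := alg_hom_ext fun a => Subtype.ext (funext fun j =>
    congrArg (fun f : c.pt ⟶ F.obj j => f a) (h j))

instance : HasLimitsOfShape J V.Alg :=
  ⟨fun F => ⟨⟨⟨sectionsCone F, sectionsConeIsLimit F⟩⟩⟩⟩

instance : HasFiniteLimits V.Alg := ⟨fun _ _ _ => inferInstance⟩

/-- The interpretations of the elements of a diagram that form a cocone. -/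
def IsCoconeMap (F : J ⥤ V.Alg) (C : V.Alg) (φ : (Σ j, F.obj j) → C) : Prop :=
  (∀ (j : J) (n : ℕ) (f : V.lang.Functions n) (x : Fin n → F.obj j),
    φ ⟨j, funMap f x⟩ = funMap f fun i => φ ⟨j, x i⟩) ∧
  ∀ (i j : J) (g : i ⟶ j) (a : F.obj i), φ ⟨j, F.map g a⟩ = φ ⟨i, a⟩

/-- Each cocone condition is an equation between terms that holds under every admissible
interpretation, so it holds for the classes of the generators. -/
theorem isCoconeMap_presentedVar (F : J ⥤ V.Alg) :
    IsCoconeMap F _ (presentedVar (IsCoconeMap F)) := by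
  refine ⟨fun j n f x => ?_, fun i j g a => ?_⟩
  · have h : (Term.func f fun i => Term.var ⟨j, x i⟩ : V.lang.Term (Σ j, F.obj j)).realize
        (presentedVar (IsCoconeMap F)) = funMap f fun i => presentedVar (IsCoconeMap F) ⟨j, x i⟩ :=
      rfl
    rw [← h, presented_realize_var]
    exact (presentedMk_eq_iff _ _ _).2 fun C φ hφ => hφ.1 j n f x
  · exact (presentedMk_eq_iff _ _ _).2 fun C φ hφ => hφ.2 i j g a

/-- The colimit cocone of a diagram of algebras. -/
noncomputable def presentedCocone (F : J ⥤ V.Alg) : Cocone F where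
  pt := presentedAlg (IsCoconeMap F)
  ι :=
    { app := fun j => homMk (fun a => presentedVar (IsCoconeMap F) ⟨j, a⟩)
        fun n f x => (isCoconeMap_presentedVar F).1 j n f x
      naturality := fun i j g => alg_hom_ext fun a => (isCoconeMap_presentedVar F).2 i j g a }

theorem isCoconeMap_cocone {F : J ⥤ V.Alg} (c : Cocone F) :
    IsCoconeMap F c.pt fun a => c.ι.app a.1 a.2 :=
  ⟨fun j _ f x => hom_map_fun (c.ι.app j) f x, fun i j g a => by
    change c.ι.app j (F.map g a) = c.ι.app i a
    rw [← ConcreteCategory.comp_apply, c.w g]⟩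

/-- The presented cocone is a colimit cocone. -/
noncomputable def presentedCoconeIsColimit (F : J ⥤ V.Alg) : IsColimit (presentedCocone F) where
  desc c := presentedDesc _ _ (isCoconeMap_cocone c)
  fac _ _ := rfl
  uniq c _ h := presented_hom_ext _ fun a =>
    congrArg (fun f : F.obj a.1 ⟶ c.pt => f a.2) (h a.1)

instance : HasColimitsOfShape J V.Alg :=
  ⟨fun F => ⟨⟨⟨presentedCocone F, presentedCoconeIsColimit F⟩⟩⟩⟩

instance : HasFiniteColimits V.Alg := ⟨fun _ _ _ => inferInstance⟩

end Limits

/-! ### Pullbacks, regular epimorphisms and Barr exactness -/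

/-- A compatible pair of elements is a compatible pair of morphisms from the free algebra on one
generator, which the pullback lifts. -/
theorem exists_of_isPullback {A B C D : V.Alg} {a : A ⟶ B} {b : A ⟶ C} {f : B ⟶ D} {g : C ⟶ D}
    (h : IsPullback a b f g) (x : B) (y : C) (hxy : f x = g y) : ∃ z : A, a z = x ∧ b z = y := by
  have w : elemHom x ≫ f = elemHom y ≫ g := by rw [elemHom_comp, elemHom_comp, hxy]
  refine ⟨h.lift _ _ w (freeVar PUnit.unit), ?_, ?_⟩
  · rw [← ConcreteCategory.comp_apply, h.lift_fst, elemHom_apply]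
  · rw [← ConcreteCategory.comp_apply, h.lift_snd, elemHom_apply]

theorem eq_of_isPullback {A B C D : V.Alg} {a : A ⟶ B} {b : A ⟶ C} {f : B ⟶ D} {g : C ⟶ D}
    (h : IsPullback a b f g) {z z' : A} (ha : a z = a z') (hb : b z = b z') : z = z' :=
  eq_of_elemHom_eq (h.hom_ext (by rw [elemHom_comp, elemHom_comp, ha])
    (by rw [elemHom_comp, elemHom_comp, hb]))

theorem isPullback_of_existsUnique {A B C D : V.Alg} {a : A ⟶ B} {b : A ⟶ C} {f : B ⟶ D}
    {g : C ⟶ D} (w : a ≫ f = b ≫ g)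
    (h : ∀ (x : B) (y : C), f x = g y → ∃ z : A, a z = x ∧ b z = y)
    (h' : ∀ z z' : A, a z = a z' → b z = b z' → z = z') : IsPullback a b f g := by
  let p := pullback.lift a b w
  have hp : IsIso p := by
    have h₁ (z : A) : pullback.fst f g (p z) = a z := by
      rw [← ConcreteCategory.comp_apply, pullback.lift_fst]
    have h₂ (z : A) : pullback.snd f g (p z) = b z := by
      rw [← ConcreteCategory.comp_apply, pullback.lift_snd]
    refine isIso_of_bijective p ⟨fun z z' hz => h' _ _ ?_ ?_, fun z => ?_⟩
    · rw [← h₁, ← h₁, hz]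
    · rw [← h₂, ← h₂, hz]
    · obtain ⟨y, hy, hy'⟩ := h (pullback.fst f g z) (pullback.snd f g z) (by
        rw [← ConcreteCategory.comp_apply, pullback.condition, ConcreteCategory.comp_apply])
      exact ⟨y, eq_of_isPullback (IsPullback.of_hasPullback f g)
        ((h₁ y).trans hy) ((h₂ y).trans hy')⟩
  exact IsPullback.of_iso_pullback ⟨w⟩ (asIso p) (pullback.lift_fst _ _ _)
    (pullback.lift_snd _ _ _)

/-- Corestricted to its range, `f` still coequalizes the pair of which `f` is the coequalizer. The
induced map is a section of the inclusion of the range, so the range is everything. -/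
theorem surjective_of_isRegularEpi {A B : V.Alg} (f : A ⟶ B) [IsRegularEpi f] :
    Function.Surjective f := by
  let S : V.lang.Substructure B.carrier := (FirstOrder.Language.Hom.range (Variety.Hom.hom f))
  have hS (b : B) : b ∈ S ↔ ∃ a, f a = b := FirstOrder.Language.Hom.mem_range
  have hf (a : A) : f a ∈ S := (hS _).2 ⟨a, rfl⟩
  let q := subAlgLift S f hf
  have hq : IsRegularEpi.left f ≫ q = IsRegularEpi.right f ≫ q := by
    refine alg_hom_ext fun a => subAlgι_injective S ?_
    rw [← ConcreteCategory.comp_apply, ← ConcreteCategory.comp_apply, Category.assoc,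
      Category.assoc, subAlgLift_comp, IsRegularEpi.w]
  have : Epi f := (IsRegularEpi.getStruct f).epi
  have hd : IsRegularEpi.desc f q hq ≫ subAlgι S = 𝟙 B := by
    rw [← cancel_epi f, ← Category.assoc, IsRegularEpi.fac, subAlgLift_comp, Category.comp_id]
  intro b
  rw [← hS, ← ConcreteCategory.id_apply b, ← hd]
  exact (IsRegularEpi.desc f q hq b : S).2

/-- A surjection is the coequalizer of its kernel pair, because a morphism that equalizes the kernel
pair is constant on the fibres. -/
theorem isRegularEpi_of_surjective {A B : V.Alg} (f : A ⟶ B) (hf : Function.Surjective f) :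
    IsRegularEpi f := by
  have hk {C : V.Alg} (k : A ⟶ C) (w : pullback.fst f f ≫ k = pullback.snd f f ≫ k) :
      ∃ g : B ⟶ C, f ≫ g = k := by
    refine exists_desc_of_surjective f hf k fun a a' h => ?_
    obtain ⟨z, rfl, rfl⟩ := exists_of_isPullback (IsPullback.of_hasPullback f f) a a' h
    rw [← ConcreteCategory.comp_apply, w, ConcreteCategory.comp_apply]
  refine ⟨⟨⟨pullback f f, pullback.fst f f, pullback.snd f f, pullback.condition,
    Cofork.IsColimit.mk _ (fun s => (hk s.π s.condition).choose)
      (fun s => (hk s.π s.condition).choose_spec) fun s m hm => alg_hom_ext fun b => ?_⟩⟩⟩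
  obtain ⟨a, rfl⟩ := hf b
  have h := hm.trans (hk s.π s.condition).choose_spec.symm
  exact congrArg (fun k : A ⟶ s.pt => k a) h

theorem isRegularEpi_iff_surjective {A B : V.Alg} (f : A ⟶ B) :
    IsRegularEpi f ↔ Function.Surjective f :=
  ⟨fun _ => surjective_of_isRegularEpi f, isRegularEpi_of_surjective f⟩

/-- The pairs `(p₁ r, p₂ r)` form a congruence, and the given relation is the kernel pair of the
quotient map. -/
theorem exists_isKernelPair {R X : V.Alg} (p₁ p₂ : R ⟶ X) [h : IsEquivalenceRelation p₁ p₂] :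
    ∃ (Y : V.Alg) (f : X ⟶ Y), IsKernelPair f p₁ p₂ := by
  obtain ⟨e⟩ := h.nonempty_equivalenceRelation
  let s : Setoid X :=
    { r := fun a b => ∃ r, p₁ r = a ∧ p₂ r = b
      iseqv :=
        { refl := fun a => ⟨e.r a, by
            rw [← ConcreteCategory.comp_apply, e.reflexivity₁, ConcreteCategory.id_apply], by
            rw [← ConcreteCategory.comp_apply, e.reflexivity₂, ConcreteCategory.id_apply]⟩
          symm := by
            rintro _ _ ⟨r, rfl, rfl⟩
            exact ⟨e.s r, by rw [← ConcreteCategory.comp_apply, e.symmetry₁], by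
              rw [← ConcreteCategory.comp_apply, e.symmetry₂]⟩
          trans := by
            rintro _ _ _ ⟨r, rfl, rfl⟩ ⟨r', hr, rfl⟩
            obtain ⟨z, rfl, rfl⟩ := exists_of_isPullback
              (IsPullback.of_isLimit e.isLimit) r r' hr.symm
            exact ⟨e.t z, by rw [← ConcreteCategory.comp_apply, e.transitivity₁,
                ConcreteCategory.comp_apply], by
              rw [← ConcreteCategory.comp_apply, e.transitivity₂, ConcreteCategory.comp_apply]⟩ } }
  have hs (n : ℕ) (f : V.lang.Functions n) (x y : Fin n → X) (hxy : ∀ i, s (x i) (y i)) :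
      s (funMap f x) (funMap f y) := by
    choose r hr hr' using hxy
    refine ⟨funMap f r, ?_, ?_⟩
    · rw [hom_map_fun]
      exact congrArg _ (funext hr)
    · rw [hom_map_fun]
      exact congrArg _ (funext hr')
  refine ⟨quotientAlg s hs, quotientAlgπ s hs, isPullback_of_existsUnique ?_ ?_ ?_⟩
  · refine alg_hom_ext fun r => ?_
    rw [ConcreteCategory.comp_apply, ConcreteCategory.comp_apply, quotientAlgπ_eq_iff]
    exact ⟨r, rfl, rfl⟩
  · exact fun a b h => (quotientAlgπ_eq_iff s hs a b).1 h
  -- Joint monicity of `p₁` and `p₂` makes an element of `R` determined by its two components.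
  · refine fun z z' h₁ h₂ => eq_of_elemHom_eq (e.right_cancellation _ _ ?_ ?_)
    · rw [elemHom_comp, elemHom_comp, h₁]
    · rw [elemHom_comp, elemHom_comp, h₂]

variable (V) in
/-- Varieties of algebras are Barr exact. -/
theorem barrExact_alg : BarrExact V.Alg where
  regular :=
    { hasCoequalizer_of_isKernelPair := fun _ => inferInstance
      regularEpiIsStableUnderBaseChange := ⟨fun {_ _ _ _ f g f' g'} sq hg => by
        rw [MorphismProperty.regularEpi_iff, isRegularEpi_iff_surjective] at hg ⊢
        intro x
        obtain ⟨y, hy⟩ := hg (f x)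
        obtain ⟨z, _, hz⟩ := exists_of_isPullback sq y x hy
        exact ⟨z, hz⟩⟩ }
  effective _ _ p₁ p₂ _ := exists_isKernelPair p₁ p₂

end Variety

/-! ### Protomodularity in terms of arbitrary pullback squares -/

theorem Pt.isIso_iff {C : Type u} [Category.{v} C] {B : C} {X Y : Pt B} (f : X ⟶ Y) :
    IsIso f ↔ IsIso f.hom := by
  refine ⟨fun h => ⟨(inv f).hom, ?_, ?_⟩, fun h => ⟨⟨inv f.hom, ?_, ?_⟩, ?_, ?_⟩⟩
  · rw [← Pt.comp_hom, IsIso.hom_inv_id, Pt.id_hom]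
  · rw [← Pt.comp_hom, IsIso.inv_hom_id, Pt.id_hom]
  · rw [IsIso.inv_comp_eq, f.hom_proj]
  · rw [IsIso.comp_inv_eq, f.sect_hom]
  · exact Pt.hom_ext (IsIso.hom_inv_id f.hom)
  · exact Pt.hom_ext (IsIso.inv_hom_id f.hom)

/-- A category with pullbacks is protomodular if and only if a morphism of points is invertible as
soon as its base change, formed with any choice of pullbacks, is. -/
theorem bournProtomodular_iff {C : Type u} [Category.{v} C] [HasPullbacks C] :
    BournProtomodular C ↔ ∀ ⦃E B : C⦄ (p : E ⟶ B) ⦃X Y : Pt B⦄ (f : X ⟶ Y) ⦃X' Y' : C⦄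
      (a : X' ⟶ X.obj) (b : X' ⟶ E) (a' : Y' ⟶ Y.obj) (b' : Y' ⟶ E) (f' : X' ⟶ Y'),
      IsPullback a b X.proj p → IsPullback a' b' Y.proj p → f' ≫ a' = a ≫ f.hom → f' ≫ b' = b →
      IsIso f' → IsIso f.hom := by
  constructor
  · rintro ⟨_, h⟩ E B p X Y f X' Y' a b a' b' f' hX hY ha hb hf'
    have key : IsIso ((Pt.changeOfBase p).map f) := by
      rw [Pt.isIso_iff]
      have : pullback.lift (pullback.fst X.proj p ≫ f.hom) (pullback.snd X.proj p)
          (Pt.pullbackMap_aux p f) = hX.isoPullback.inv ≫ f' ≫ hY.isoPullback.hom := by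
        rw [Iso.eq_inv_comp]
        refine pullback.hom_ext ?_ ?_
        · rw [Category.assoc, pullback.lift_fst, hX.isoPullback_hom_fst_assoc, Category.assoc,
            hY.isoPullback_hom_fst, ha]
        · rw [Category.assoc, pullback.lift_snd, hX.isoPullback_hom_snd, Category.assoc,
            hY.isoPullback_hom_snd, hb]
      change IsIso (pullback.lift (pullback.fst X.proj p ≫ f.hom) (pullback.snd X.proj p)
        (Pt.pullbackMap_aux p f))
      rw [this]
      infer_instance
    rw [← Pt.isIso_iff]
    exact (h p).reflects f
  · refine fun h => ⟨inferInstance, fun E B p => ⟨fun {X Y} f hf => ?_⟩⟩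
    rw [Pt.isIso_iff] at hf ⊢
    exact h p f _ _ _ _ _ (IsPullback.of_hasPullback X.proj p) (IsPullback.of_hasPullback Y.proj p)
      (pullback.lift_fst _ _ _) (pullback.lift_snd _ _ _) hf

namespace Variety

open FirstOrder.Language FirstOrder.Language.Structure

variable {V : Variety.{u}}

/-! ### Terms from protomodularity -/

/-- The morphism of free algebras that identifies the two generators. -/
noncomputable def codiagonal (V : Variety.{u}) :
    V.freeAlg (ULift.{u} (Fin 2)) ⟶ V.freeAlg PUnit.{u + 1} :=
  freeDesc fun _ => freeVar PUnit.unit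

/-- The elements of the free algebra on two generators that become constant once the generators
are identified. -/
noncomputable def codiagonalKernel (V : Variety.{u}) :
    V.lang.Substructure (V.freeAlg (ULift.{u} (Fin 2))).carrier :=
  (Substructure.closure V.lang (∅ : Set (V.freeAlg PUnit.{u + 1}).carrier)).comap
    (Variety.Hom.hom (codiagonal V))

theorem mem_codiagonalKernel (a : V.freeAlg (ULift.{u} (Fin 2))) :
    a ∈ codiagonalKernel V ↔
      codiagonal V a ∈ Substructure.closure V.lang (∅ : Set (V.freeAlg PUnit.{u + 1}).carrier) := Iff.rfl

/-- In a protomodular variety, the free algebra on two generators is generated by the first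
generator and the elements that become constant once the generators are identified. -/
theorem closure_codiagonalKernel_eq_top (h : BournProtomodular V.Alg) :
    Substructure.closure V.lang (insert (freeVar ⟨0⟩)
      (codiagonalKernel V : Set (V.freeAlg (ULift.{u} (Fin 2))).carrier)) = ⊤ := by
  set S := Substructure.closure V.lang (insert (freeVar ⟨0⟩)
    (codiagonalKernel V : Set (V.freeAlg (ULift.{u} (Fin 2))).carrier))
  let E := Substructure.closure V.lang (∅ : Set (V.freeAlg PUnit.{u + 1}).carrier)
  let K := codiagonalKernel V
  have hK (a) (ha : a ∈ K) : a ∈ S := Substructure.subset_closure (Set.mem_insert_of_mem _ ha)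
  let s : V.freeAlg PUnit.{u + 1} ⟶ V.freeAlg (ULift.{u} (Fin 2)) := elemHom (freeVar ⟨0⟩)
  have hs (a) : s a ∈ S := by
    obtain ⟨t, rfl⟩ := exists_realize_freeVar a
    rw [hom_realize]
    exact Term.realize_mem t _ fun _ => Substructure.subset_closure (Set.mem_insert _ _)
  let Y : Pt (V.freeAlg PUnit.{u + 1}) := ⟨_, codiagonal V, s, free_hom_ext fun _ => rfl⟩
  let X : Pt (V.freeAlg PUnit.{u + 1}) :=
    ⟨subAlg S, subAlgι S ≫ codiagonal V, subAlgLift S s hs, Y.sect_proj⟩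
  let f : X ⟶ Y := ⟨subAlgι S, rfl, rfl⟩
  let k : subAlg K ⟶ subAlg E := subAlgLift E (subAlgι K ≫ codiagonal V) fun a => a.2
  let a : subAlg K ⟶ X.obj := subAlgLift S (subAlgι K) fun a => hK _ a.2
  -- Since `K` is contained in `S`, both points have `K` as their pullback along the inclusion of
  -- the constants, and `f` pulls back to the identity of `K`. Protomodularity then makes the
  -- inclusion of `S` invertible.
  have hiso : IsIso f.hom := by
    refine bournProtomodular_iff.1 h (subAlgι E) f a k (subAlgι K) k (𝟙 _)
      (isPullback_of_existsUnique rfl ?_ ?_) (isPullback_of_existsUnique rfl ?_ ?_) rfl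
      (Category.id_comp _) inferInstance
    · intro x y hxy
      have hx : subAlgι S x ∈ K := by
        rw [mem_codiagonalKernel]
        change X.proj x ∈ _
        rw [hxy]
        exact y.2
      exact ⟨(⟨_, hx⟩ : K), rfl, subAlgι_injective E hxy⟩
    · intro z z' hz _
      exact subAlgι_injective K (congrArg (subAlgι S) hz)
    · intro x y hxy
      have hx : x ∈ K := by
        rw [mem_codiagonalKernel]
        change Y.proj x ∈ _
        rw [hxy]
        exact y.2
      exact ⟨(⟨_, hx⟩ : K), rfl, subAlgι_injective E hxy⟩
    · intro z z' hz _
      exact subAlgι_injective K hz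
  refine eq_top_iff.2 fun b _ => ?_
  obtain ⟨c, rfl⟩ := (bijective_of_isIso f.hom).2 b
  exact c.2

end Variety

namespace Variety

open FirstOrder.Language FirstOrder.Language.Structure

variable {V : Variety.{u}}

/-- A term in variables from `Option K` only involves finitely many of them. -/
theorem exists_fin_term (L : FirstOrder.Language.{u, 0}) {K M : Type u} [L.Structure M] (x : M)
    (φ : K → M) (t : L.Term (Option K)) : ∃ (n : ℕ) (k : Fin n → K) (s : L.Term (Fin (n + 1))),
      s.realize (Fin.cons x fun i => φ (k i) : Fin (n + 1) → M) =
        t.realize fun o => o.elim x φ := by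
  classical
  let S : Finset K := t.varFinset.eraseNone
  let e := S.equivFin
  -- Index 0 is reserved for `none`, which stands for `x`; the elements of `S` occupy the
  -- successors.
  let g (o : t.varFinset) : Fin (S.card + 1) :=
    if h : ∃ a : K, o.1 = some a then
      (e ⟨h.choose, Finset.mem_eraseNone.2 (h.choose_spec ▸ o.2)⟩).succ
    else 0
  refine ⟨S.card, fun i => (e.symm i).1, t.restrictVar g, Term.realize_restrictVar _ fun o => ?_⟩
  rcases ho : o.1 with _ | a
  · have h : ¬ ∃ a : K, o.1 = some a := by simp [ho]
    simp [g, h]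
  · have h : ∃ a : K, o.1 = some a := ⟨a, ho⟩
    have ha : h.choose = a := Option.some_injective _ (h.choose_spec.symm.trans ho)
    simp [g, h, ha]

theorem exists_term_of_mem_closure_insert (L : FirstOrder.Language.{u, 0}) {M : Type u}
    [L.Structure M] (x : M) (K : Set M) {y : M} (hy : y ∈ Substructure.closure L (insert x K)) :
    ∃ (n : ℕ) (k : Fin n → K) (s : L.Term (Fin (n + 1))),
      s.realize (Fin.cons x fun i => (k i : M) : Fin (n + 1) → M) = y := by
  classical
  obtain ⟨t, rfl⟩ := Substructure.mem_closure_iff_exists_term.1 hy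
  -- As `x` may itself belong to `K`, membership in `K` is tested first; a generator outside `K`
  -- must be `x`.
  let g (a : (insert x K : Set M)) : Option K := if h : a.1 ∈ K then some ⟨a.1, h⟩ else none
  obtain ⟨n, k, s, hs⟩ := exists_fin_term L x (fun k : K => (k : M)) (t.relabel g)
  refine ⟨n, k, s, hs.trans ?_⟩
  rw [Term.realize_relabel]
  congr 1
  ext a
  by_cases h : a.1 ∈ K
  · simp [g, h]
  · simpa [g, h] using (a.2.resolve_right h).symm

/-- The second generator is a term `t` in the first one and finitely many elements of the kernel.
These elements are binary terms in the generators, and their images under the codiagonal are closed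
terms. -/
theorem nonempty_protomodularTerms_of_bournProtomodular (h : BournProtomodular V.Alg) :
    ∃ n : ℕ, Nonempty (V.ProtomodularTerms n) := by
  have hy : freeVar ⟨1⟩ ∈ Substructure.closure V.lang (insert (freeVar ⟨0⟩)
      (codiagonalKernel V : Set (V.freeAlg (ULift.{u} (Fin 2))).carrier)) := by
    rw [closure_codiagonalKernel_eq_top h]
    exact Substructure.mem_top _
  obtain ⟨n, k, t, ht⟩ := exists_term_of_mem_closure_insert V.lang _ _ hy
  have hd (i : Fin n) : ∃ d : V.lang.Term (ULift.{u} (Fin 2)), d.realize freeVar = (k i).1 :=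
    exists_realize_freeVar _
  choose d hd using hd
  have he (i : Fin n) : ∃ e : V.lang.Term Empty,
      e.realize Empty.elim = codiagonal V (k i).1 := by
    obtain ⟨e, he⟩ := Substructure.mem_closure_iff_exists_term.1
      ((mem_codiagonalKernel _).1 (k i).2)
    refine ⟨e.relabel fun a => a.2.elim, (Term.realize_relabel).trans (Eq.trans ?_ he)⟩
    congr 1
    ext a
    exact a.2.elim
  choose e he using he
  refine ⟨n, ⟨⟨e, fun i => (d i).relabel ULift.down, t, fun A x y => ?_, fun A x i => ?_⟩⟩⟩
  -- The expression of the second free generator by `t` is an equation in the free algebra, so it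
  -- holds under the interpretation of the generators by `x` and `y`.
  · have key := (realize_freeVar_eq_iff (V := V)
      (t.subst (Fin.cons (Term.var ⟨0⟩) d)) (Term.var ⟨1⟩)).1 (by
        rw [Term.realize_subst]
        refine Eq.trans ?_ ht
        congr 1
        ext i
        refine Fin.cases rfl (fun j => ?_) i
        exact hd j) A fun i => ![x, y] i.down
    rw [Term.realize_subst] at key
    refine Eq.trans ?_ key
    congr 1
    ext i
    refine Fin.cases rfl (fun j => ?_) i
    exact Term.realize_relabel
  -- The same transfer, now in the free algebra on one generator, where the codiagonal sends the
  -- element of `d i` to the constant `e i`.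
  · have key := (realize_freeVar_eq_iff (V := V) ((d i).relabel fun _ => PUnit.unit.{u + 1})
      ((e i).relabel Empty.elim)).1 (by
        rw [Term.realize_relabel, Term.realize_relabel]
        refine Eq.trans ?_ ((he i).symm.trans ?_)
        · rw [← hd, hom_realize]
          rfl
        · congr 1
          ext a
          exact a.elim) A fun _ => x
    rw [Term.realize_relabel, Term.realize_relabel] at key
    rw [Term.realize_relabel]
    refine Eq.trans ?_ (key.trans ?_)
    · congr 1
      ext ⟨j⟩
      fin_cases j <;> rfl
    · congr 1
      ext a
      exact a.elim

/-! ### Protomodularity from terms -/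

/-- Both `x` and `y` equal `t(x, e₁, …, eₙ)`. For `n = 0` the condition is empty and any two
elements coincide. -/
theorem ProtomodularTerms.eq_of_d_eq {n : ℕ} (T : V.ProtomodularTerms n) {A : V.Alg} {x y : A}
    (h : ∀ k, (T.d k).realize ![x, y] = (T.e k).realize (Empty.elim : Empty → A)) : x = y := by
  have h₁ := T.t_eq A x x
  have h₂ := T.t_eq A x y
  simp only [T.d_eq] at h₁
  simp only [h] at h₂
  exact h₁.symm.trans h₂

theorem not_containsEmpty_of_term (e : V.lang.Term Empty) : ¬ V.ContainsEmpty :=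
  fun ⟨_, hA⟩ => hA.false (e.realize Empty.elim)

theorem ProtomodularTerms.bournProtomodular {n : ℕ} (T : V.ProtomodularTerms n) :
    BournProtomodular V.Alg := by
  refine bournProtomodular_iff.2 fun E B p X Y f X' Y' a b a' b' f' hX hY ha hb hf => ?_
  have hproj (x : X.obj) : Y.proj (f.hom x) = X.proj x := by
    rw [← f.hom_proj, ConcreteCategory.comp_apply]
  have hsect (z : B) : f.hom (X.sect z) = Y.sect z := by
    rw [← f.sect_hom, ConcreteCategory.comp_apply]
  have ha (z : X') : a' (f' z) = f.hom (a z) := by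
    rw [← ConcreteCategory.comp_apply, ha, ConcreteCategory.comp_apply]
  have hf' := bijective_of_isIso f'
  -- the morphism is bijective between the fibres over the image of `p`
  have hinj (x x' : X.obj) (z : E) (hx : X.proj x = p z) (hx' : X.proj x' = p z)
      (h : f.hom x = f.hom x') : x = x' := by
    obtain ⟨w, rfl, hw⟩ := exists_of_isPullback hX x z hx
    obtain ⟨w', rfl, hw'⟩ := exists_of_isPullback hX x' z hx'
    have : f' w = f' w' := by
      refine eq_of_isPullback hY ((ha w).trans (h.trans (ha w').symm)) ?_
      rw [← ConcreteCategory.comp_apply, ← ConcreteCategory.comp_apply, hb, hw, hw']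
    rw [hf'.1 this]
  have hsurj (y : Y.obj) (z : E) (hy : Y.proj y = p z) : ∃ x, f.hom x = y := by
    obtain ⟨w, rfl, _⟩ := exists_of_isPullback hY y z hy
    obtain ⟨v, rfl⟩ := hf'.2 w
    exact ⟨a v, (ha v).symm⟩
  -- Constants of `B` are images under `p` of constants of `E`, so the fibres over them are among
  -- those controlled by `f'`.
  have hconst (k : Fin n) : p ((T.e k).realize Empty.elim) = (T.e k).realize Empty.elim :=
    hom_realize_const p _
  refine isIso_of_bijective _ ⟨fun x x' h => ?_, fun y => ?_⟩
  -- The element `dₖ(x, x')` lies over `dₖ(b, b) = eₖ`, and its image under `f` is also `eₖ`;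
  -- injectivity on that fibre gives `dₖ(x, x') = eₖ`.
  · refine T.eq_of_d_eq fun k => hinj _ _ ((T.e k).realize Empty.elim) ?_ ?_ ?_
    · rw [hom_realize₂, ← hproj, ← hproj, h, T.d_eq, hconst]
    · rw [hom_realize_const, hconst]
    · rw [hom_realize₂, h, T.d_eq, hom_realize_const]
  -- The difference between `y` and the section value at its projection lies over `eₖ`, so it has a
  -- preimage. Applying `t` to the section value in `X` and these preimages yields a preimage of
  -- `y`.
  · have hd (k : Fin n) : ∃ x, f.hom x = (T.d k).realize ![Y.sect (Y.proj y), y] := by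
      refine hsurj _ ((T.e k).realize Empty.elim) ?_
      rw [hom_realize₂, ← ConcreteCategory.comp_apply, Y.sect_proj, ConcreteCategory.id_apply,
        T.d_eq, hconst]
    choose x hx using hd
    refine ⟨T.t.realize (Fin.cons (X.sect (Y.proj y)) x : Fin (n + 1) → X.obj), ?_⟩
    refine (hom_realize _ _ _).trans (Eq.trans ?_ (T.t_eq Y.obj (Y.sect (Y.proj y)) y))
    congr 1
    ext i
    exact Fin.cases (hsect _) hx i

theorem bournProtomodular_iff_exists_terms :
    BournProtomodular V.Alg ↔ ∃ n : ℕ, Nonempty (V.ProtomodularTerms n) :=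
  ⟨nonempty_protomodularTerms_of_bournProtomodular, fun ⟨_, ⟨T⟩⟩ => T.bournProtomodular⟩

/-! ### Ideally exact and semi-abelian varieties -/

theorem subsingleton_of_isTerminal {T : V.Alg} (hT : IsTerminal T) : Subsingleton T :=
  ⟨fun _ _ => eq_of_elemHom_eq (hT.hom_ext _ _)⟩

/-- The terminal algebra is a singleton, so 0 → 1 is surjective exactly when the initial algebra is
nonempty. The initial algebra maps to every algebra, hence is empty as soon as some algebra is. -/
theorem ideallyExact_iff :
    IdeallyExact V.Alg ↔ BournProtomodular V.Alg ∧ ¬ V.ContainsEmpty := by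
  refine ⟨fun h => ⟨h.protomodular, fun ⟨A, hA⟩ => ?_⟩, fun ⟨h, hV⟩ =>
    ⟨barrExact_alg V, h, inferInstance, fun I T hI hT => ?_⟩⟩
  · have := h.regularEpi initialIsInitial V.punitAlgIsTerminal
    obtain ⟨a, _⟩ := surjective_of_isRegularEpi
      (initialIsInitial.to V.punitAlg) PUnit.unit
    exact hA.false (initialIsInitial.to A a)
  · refine isRegularEpi_of_surjective _ fun b => ?_
    have := subsingleton_of_isTerminal hT
    have : Nonempty I := not_isEmpty_iff.1 fun hE => hV ⟨I, hE⟩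
    exact ⟨Classical.arbitrary I, Subsingleton.elim _ _⟩

theorem ProtomodularTerms.ideallyExact {n : ℕ} [NeZero n] (T : V.ProtomodularTerms n) :
    IdeallyExact V.Alg :=
  ideallyExact_iff.2 ⟨T.bournProtomodular, not_containsEmpty_of_term (T.e 0)⟩

theorem nonempty_terms_zero_iff : Nonempty (V.ProtomodularTerms 0) ↔ V.AtMostOneElement := by
  refine ⟨fun ⟨T⟩ A => ⟨fun x y => T.eq_of_d_eq fun k => k.elim0⟩, fun h => ⟨?_⟩⟩
  exact ⟨fun k => k.elim0, fun k => k.elim0, Term.var 0,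
    fun A x y => (h A).elim _ _, fun A x k => k.elim0⟩

theorem ideallyExact_iff_of_not_atMostOneElement (hV : ¬ V.AtMostOneElement) :
    IdeallyExact V.Alg ↔ BournProtomodular V.Alg := by
  refine ⟨fun h => h.protomodular, fun h => ?_⟩
  obtain ⟨_ | n, ⟨T⟩⟩ := bournProtomodular_iff_exists_terms.1 h
  · exact (hV (nonempty_terms_zero_iff.1 ⟨T⟩)).elim
  · exact T.ideallyExact

theorem ProtomodularTerms.semiAbelian_iff {n : ℕ} (T : V.ProtomodularTerms n) :
    HasZeroObject V.Alg ↔ SemiAbelian V.Alg :=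
  ⟨fun h => ⟨h, barrExact_alg V, T.bournProtomodular, inferInstance⟩, fun h => h.pointed⟩

/-- A zero object has one element and maps to every algebra, so all constants are the image of that
element. -/
theorem const_eq_of_hasZeroObject (h : HasZeroObject V.Alg) (A : V.Alg) (s t : V.lang.Term Empty) :
    s.realize (Empty.elim : Empty → A) = t.realize (Empty.elim : Empty → A) := by
  obtain ⟨Z, hZ⟩ := h
  have := subsingleton_of_isTerminal hZ.isTerminal
  rw [← hom_realize_const (hZ.to_ A), ← hom_realize_const (hZ.to_ A)]
  exact congrArg _ (Subsingleton.elim _ _)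

end Variety

namespace Variety

open FirstOrder.Language FirstOrder.Language.Structure

variable {V : Variety.{u}}

/-! ### Loops and groups with additional structure -/

theorem realize_subst₁ (L : FirstOrder.Language.{u, 0}) {M α : Type*} [L.Structure M]
    (t : L.Term (Fin 1)) (s : L.Term α) (v : α → M) :
    (t.subst ![s]).realize v = t.realize ![s.realize v] := by
  rw [Term.realize_subst]
  congr 1
  ext i
  fin_cases i; rfl

theorem realize_subst₂ (L : FirstOrder.Language.{u, 0}) {M α : Type*} [L.Structure M]
    (t : L.Term (Fin 2)) (s₁ s₂ : L.Term α) (v : α → M) :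
    (t.subst ![s₁, s₂]).realize v = t.realize ![s₁.realize v, s₂.realize v] := by
  rw [Term.realize_subst]
  congr 1
  ext i
  fin_cases i <;> rfl

/-- Protomodular terms for `n = 1`. -/
def ProtomodularTerms.ofOne (e : V.lang.Term Empty) (d t : V.lang.Term (Fin 2))
    (ht : ∀ (A : V.Alg) (x y : A), t.realize ![x, d.realize ![x, y]] = y)
    (hd : ∀ (A : V.Alg) (x : A),
      d.realize ![x, x] = e.realize (Empty.elim : Empty → A)) : V.ProtomodularTerms 1 where
  e _ := e
  d _ := d
  t := t
  t_eq A x y := by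
    refine Eq.trans ?_ (ht A x y)
    congr 1
    ext i
    fin_cases i <;> rfl
  d_eq A x _ := hd A x

/-- Loop terms yield protomodular terms for `n = 1`. -/
def LoopTerms.protomodularTerms (T : V.LoopTerms) : V.ProtomodularTerms 1 :=
  .ofOne T.e T.ldiv T.mul T.mul_ldiv fun A x => by
    -- The instance `x \ (x · e) = e` becomes `x \ x = e`.
    have h := T.ldiv_mul A x (T.e.realize Empty.elim)
    rwa [T.mul_one] at h

/-- The group structure on an algebra of a variety with group terms. -/
abbrev GroupTerms.group (T : V.GroupTerms) (A : V.Alg) : Group A :=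
  letI : Mul A := ⟨fun x y => T.mul.realize ![x, y]⟩
  letI : Inv A := ⟨fun x => T.inv.realize ![x]⟩
  letI : One A := ⟨T.e.realize Empty.elim⟩
  Group.ofLeftAxioms (T.assoc A) (T.one_mul A) (T.inv_mul A)

/-- Group terms yield protomodular terms for `n = 1`. -/
def GroupTerms.protomodularTerms (T : V.GroupTerms) : V.ProtomodularTerms 1 :=
  .ofOne T.e (T.mul.subst ![T.inv.subst ![Term.var 0], Term.var 1]) T.mul
    (fun A x y => by
      rw [realize_subst₂, realize_subst₁]
      let _ := T.group A
      exact mul_inv_cancel_left x y)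
    (fun A x => by
      rw [realize_subst₂, realize_subst₁]
      exact T.inv_mul A x)

/-- The identities `f(e, …, e) = e` say that the constant map with value `e` is a homomorphism from
the one-element algebra; it is the only one, since homomorphisms preserve `e`. -/
theorem hasZeroObject_of_isGroupsWithMultipleOperators (h : V.IsGroupsWithMultipleOperators) :
    HasZeroObject V.Alg := by
  obtain ⟨G, hG⟩ := h
  refine ⟨V.punitAlg, fun A => ⟨⟨⟨homMk (fun _ => G.e.realize Empty.elim)
    fun n f _ => (hG A n f).symm⟩, fun g => alg_hom_ext fun a => ?_⟩⟩,
    fun A => ⟨⟨⟨V.punitAlgIsTerminal.from A⟩, fun g => V.punitAlgIsTerminal.hom_ext _ _⟩⟩⟩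
  exact (hom_realize_const g G.e)

/-! ### Varieties of algebras with at most one element -/

/-- The variety without operations in which all elements are equal. -/
def trivialVariety : Variety.{u} where
  lang := ⟨fun _ => PEmpty, fun _ => Empty⟩
  algebraic _ := inferInstanceAs (IsEmpty Empty)
  identities := {(Term.var 0, Term.var 1)}

/-- The variety with one constant in which all elements are equal. -/
def trivialPointedVariety : Variety.{u} where
  lang := ⟨fun n => {_u : PUnit.{u + 1} // n = 0}, fun _ => Empty⟩
  algebraic _ := inferInstanceAs (IsEmpty Empty)
  identities := {(Term.var 0, Term.var 1)}

theorem atMostOneElement_of_mem (h : (Term.var 0, Term.var 1) ∈ V.identities) :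
    V.AtMostOneElement :=
  fun A => ⟨fun x y => A.sat _ h fun n => if n = 0 then x else y⟩

theorem trivialVariety_atMostOneElement : trivialVariety.{u}.AtMostOneElement :=
  atMostOneElement_of_mem rfl

theorem trivialPointedVariety_atMostOneElement : trivialPointedVariety.{u}.AtMostOneElement :=
  atMostOneElement_of_mem rfl

theorem trivialVariety_containsEmpty : trivialVariety.{u}.ContainsEmpty :=
  ⟨{ carrier := PEmpty
     str := ⟨fun f => PEmpty.elim f, fun _ _ => False⟩
     sat := fun _ _ x => (x 0).elim }, inferInstanceAs (IsEmpty PEmpty)⟩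

theorem trivialPointedVariety_not_containsEmpty : ¬ trivialPointedVariety.{u}.ContainsEmpty :=
  fun ⟨A, hA⟩ => hA.false (funMap (L := trivialPointedVariety.lang) (M := A.carrier) (n := 0)
    ⟨PUnit.unit, rfl⟩ Fin.elim0)

theorem nonempty_of_constant {W : Variety.{u}} (h : V.ContainsEmpty → W.ContainsEmpty)
    (c : W.lang.Functions 0) (A : V.Alg) : Nonempty A := by
  by_contra hA
  obtain ⟨B, hB⟩ := h ⟨A, not_nonempty_iff.1 hA⟩
  exact hB.false (funMap c Fin.elim0)

/-- An operation with an argument exhibits an element. A constant of `W` excludes the empty algebra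
from `W`, hence from `V`. -/
theorem nonempty_of_operation {W : Variety.{u}} (h : V.ContainsEmpty → W.ContainsEmpty)
    (A : V.Alg) : {n : ℕ} → (f : W.lang.Functions n) → (Fin n → A) → Nonempty A
  | 0, f, _ => nonempty_of_constant h f A
  | _ + 1, _, x => ⟨x 0⟩

variable {W : Variety.{u}}

/-- An algebra with at most one element as an algebra of another variety. -/
noncomputable def transferAlg (hV : V.AtMostOneElement) (h : V.ContainsEmpty → W.ContainsEmpty)
    (A : V.Alg) : W.Alg where
  carrier := A
  str := ⟨fun f x => (nonempty_of_operation h A f x).some, fun _ _ => False⟩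
  sat _ _ _ := (hV A).elim _ _

/-- The functor between varieties of algebras with at most one element that does not change the
underlying sets. -/
noncomputable def transfer (hV : V.AtMostOneElement) (h : V.ContainsEmpty → W.ContainsEmpty) :
    V.Alg ⥤ W.Alg where
  obj := transferAlg hV h
  map {A B} g := homMk (A := transferAlg hV h A) (B := transferAlg hV h B) (fun a : A => g a)
    fun _ _ _ => (hV B).elim _ _

/-- Varieties of algebras with at most one element are equivalent if both or neither of them
contain the empty algebra. -/
noncomputable def transferEquivalence (hV : V.AtMostOneElement) (hW : W.AtMostOneElement)
    (h : V.ContainsEmpty ↔ W.ContainsEmpty) : V.Alg ≌ W.Alg :=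
  CategoryTheory.Equivalence.mk (transfer hV h.1) (transfer hW h.2)
    (NatIso.ofComponents (fun A =>
      { hom := homMk (B := transferAlg hW h.2 (transferAlg hV h.1 A)) (fun a : A => a)
          fun _ _ _ => (hV A).elim _ _
        inv := homMk (A := transferAlg hW h.2 (transferAlg hV h.1 A)) (fun a : A => a)
          fun _ _ _ => (hV A).elim _ _ }) fun _ => rfl)
    (NatIso.ofComponents (fun A =>
      { hom := homMk (A := transferAlg hV h.1 (transferAlg hW h.2 A)) (fun a : A => a)
          fun _ _ _ => (hW A).elim _ _
        inv := homMk (B := transferAlg hV h.1 (transferAlg hW h.2 A)) (fun a : A => a)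
          fun _ _ _ => (hW A).elim _ _ }) fun _ => rfl)

/-- All one-element algebras are isomorphic, so only an empty algebra can produce a second
isomorphism class. The right-hand side is invariant under equivalence. -/
theorem containsEmpty_iff_of_atMostOneElement (hV : V.AtMostOneElement) :
    V.ContainsEmpty ↔ ∃ A B : V.Alg, IsEmpty (A ≅ B) := by
  refine ⟨fun ⟨A, hA⟩ => ⟨V.punitAlg, A, ⟨fun e => hA.false (e.hom PUnit.unit)⟩⟩,
    fun ⟨A, B, hAB⟩ => ?_⟩
  by_contra hE
  have hne (C : V.Alg) : Nonempty C := not_isEmpty_iff.1 fun h => hE ⟨C, h⟩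
  let f (C D : V.Alg) : C ⟶ D :=
    homMk (fun _ => (hne D).some) fun _ _ _ => (hV D).elim _ _
  exact hAB.false ⟨f A B, f B A, alg_hom_ext fun _ => (hV A).elim _ _,
    alg_hom_ext fun _ => (hV B).elim _ _⟩

theorem ContainsEmpty.of_equivalence (hV : V.AtMostOneElement) (hW : W.AtMostOneElement)
    (e : V.Alg ≌ W.Alg) (h : V.ContainsEmpty) : W.ContainsEmpty := by
  rw [containsEmpty_iff_of_atMostOneElement hV] at h
  rw [containsEmpty_iff_of_atMostOneElement hW]
  obtain ⟨A, B, hAB⟩ := h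
  exact ⟨e.functor.obj A, e.functor.obj B, ⟨fun i => hAB.false (e.functor.preimageIso i)⟩⟩

theorem nonempty_equivalence_iff (hV : V.AtMostOneElement) (hW : W.AtMostOneElement) :
    Nonempty (V.Alg ≌ W.Alg) ↔ (V.ContainsEmpty ↔ W.ContainsEmpty) :=
  ⟨fun ⟨e⟩ => ⟨.of_equivalence hV hW e, .of_equivalence hW hV e.symm⟩,
    fun h => ⟨transferEquivalence hV hW h⟩⟩

theorem AtMostOneElement.bournProtomodular (hV : V.AtMostOneElement) :
    BournProtomodular V.Alg :=
  (nonempty_terms_zero_iff.2 hV).some.bournProtomodular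

end Variety

/-! ### Lattices -/

section Lattice

variable {P : Type w} [Lattice P]

/-- The pair coequalized by `f` consists of equal morphisms, so the identity of `X` descends along
`f`. -/
theorem IsRegularEpi.isIso_of_isThin {C : Type u} [Category.{v} C] [Quiver.IsThin C] {X Y : C}
    (f : X ⟶ Y) [IsRegularEpi f] : IsIso f :=
  ⟨IsRegularEpi.desc f (𝟙 X) (Subsingleton.elim _ _), Subsingleton.elim _ _,
    Subsingleton.elim _ _⟩

theorem isRegularEpi_of_isIso {C : Type u} [Category.{v} C] {X Y : C} (f : X ⟶ Y) [IsIso f] :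
    IsRegularEpi f :=
  ⟨⟨RegularEpi.ofIso (asIso f)⟩⟩

theorem hasCoequalizer_of_isThin {C : Type u} [Category.{v} C] [Quiver.IsThin C] {X Y : C}
    (f g : X ⟶ Y) : HasCoequalizer f g := by
  obtain rfl := Subsingleton.elim f g
  infer_instance

/-- Regular epimorphisms are isomorphisms here, hence pullback stable. The two legs of an
equivalence relation coincide and are inverted by reflexivity, so they form the kernel pair of an
identity. -/
theorem barrExact_of_isTop {a : P} (ha : IsTop a) : BarrExact P := by
  let _ : OrderTop P := { top := a, le_top := ha }
  exact
    { regular :=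
        { hasCoequalizer_of_isKernelPair := fun _ => hasCoequalizer_of_isThin _ _
          regularEpiIsStableUnderBaseChange := ⟨fun {_ _ _ _ f g f' g'} sq hg => by
            rw [MorphismProperty.regularEpi_iff] at hg ⊢
            have := IsRegularEpi.isIso_of_isThin g
            have := sq.isIso_snd_of_isIso
            exact isRegularEpi_of_isIso g'⟩ }
      effective := fun R X p₁ p₂ h => by
        obtain ⟨e⟩ := h.nonempty_equivalenceRelation
        obtain rfl := Subsingleton.elim p₁ p₂
        have : IsIso p₁ := ⟨e.r, Subsingleton.elim _ _, Subsingleton.elim _ _⟩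
        exact ⟨X, 𝟙 X, IsPullback.of_vert_isIso ⟨rfl⟩⟩ }

/-- Binary meets suffice for pullbacks. Every point over `B` is isomorphic to `B`, so all morphisms
of points are already invertible. -/
theorem bournProtomodular_lattice : BournProtomodular P := by
  have : HasPullbacks P := ⟨fun F => ⟨⟨⟨{
    pt := F.obj WalkingCospan.left ⊓ F.obj WalkingCospan.right
    π := {
      app := fun
        | none => homOfLE (inf_le_left.trans (leOfHom (F.map WalkingCospan.Hom.inl)))
        | some WalkingPair.left => homOfLE inf_le_left
        | some WalkingPair.right => homOfLE inf_le_right } },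
    { lift := fun s => homOfLE (le_inf (leOfHom (s.π.app WalkingCospan.left))
        (leOfHom (s.π.app WalkingCospan.right))) }⟩⟩⟩⟩
  exact ⟨this, fun E B p => ⟨fun {X Y} f _ => (Pt.isIso_iff f).2
    ⟨Y.proj ≫ X.sect, Subsingleton.elim _ _, Subsingleton.elim _ _⟩⟩⟩

/-- A regular epimorphism 0 → 1 is an isomorphism, which makes the least and the greatest element
equal. -/
theorem ideallyExact_lattice_iff : IdeallyExact P ↔ ∃ a : P, ∀ b : P, b = a := by
  refine ⟨fun h => ?_, fun ⟨a, ha⟩ => ?_⟩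
  · have := h.barrExact.regular
    have := h.hasFiniteCoproducts
    have hr := h.regularEpi (initialIsInitial (C := P)) terminalIsTerminal
    have := IsRegularEpi.isIso_of_isThin (initialIsInitial.to (⊤_ P))
    have hle : (⊤_ P) ≤ ⊥_ P := leOfHom (inv (initialIsInitial.to (⊤_ P)))
    exact ⟨⊥_ P, fun b => le_antisymm ((leOfHom (terminal.from b)).trans hle)
      (leOfHom (initial.to b))⟩
  · have : Subsingleton P := ⟨fun b c => (ha b).trans (ha c).symm⟩
    refine ⟨barrExact_of_isTop (a := a) fun b => (ha b).le, bournProtomodular_lattice, ?_,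
      fun I T hI _ => ?_⟩
    · let _ : OrderBot P := { bot := a, bot_le := fun b => (ha b).ge }
      infer_instance
    · have : IsIso (hI.to T) := ⟨homOfLE (Subsingleton.elim T I).le, Subsingleton.elim _ _,
        Subsingleton.elim _ _⟩
      exact isRegularEpi_of_isIso _

end Lattice

/-! ### Transport along equivalences -/

section Transport

variable {C : Type u} [Category.{v} C] {D : Type*} [Category* D]

theorem isRegularEpi_map {X Y : C} (f : X ⟶ Y) [IsRegularEpi f] (F : C ⥤ D) [F.IsEquivalence] :
    IsRegularEpi (F.map f) :=
  ⟨⟨⟨_, F.map (IsRegularEpi.left f), F.map (IsRegularEpi.right f), by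
    rw [← F.map_comp, IsRegularEpi.w, F.map_comp],
    isColimitCoforkMapOfIsColimit F _ (IsRegularEpi.isColimit f)⟩⟩⟩

theorem isRegularEpi_of_map (F : C ⥤ D) [F.IsEquivalence] {X Y : C} (f : X ⟶ Y)
    [IsRegularEpi (F.map f)] : IsRegularEpi f := by
  have := isRegularEpi_map (F.map f) F.inv
  exact (MorphismProperty.arrow_mk_iso_iff (MorphismProperty.regularEpi C)
    (Arrow.isoMk (F.asEquivalence.unitIso.app X) (F.asEquivalence.unitIso.app Y)
      (F.asEquivalence.unit_naturality f) :
      Arrow.mk f ≅ Arrow.mk (F.inv.map (F.map f)))).2 this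

/-- Assuming all coequalizers in `D`, as any variety has, lets them be transported as colimits of a
fixed shape. -/
theorem BarrExact.of_equivalence [HasCoequalizers D] (F : C ⥤ D) [F.IsEquivalence]
    (h : BarrExact D) : BarrExact C := by
  have := h.regular
  have : HasCoequalizers C := Adjunction.hasColimitsOfShape_of_equivalence F
  have : HasFiniteLimits C := ⟨fun _ _ _ => Adjunction.hasLimitsOfShape_of_equivalence F⟩
  refine
    { regular :=
        { hasCoequalizer_of_isKernelPair := fun _ => inferInstance
          regularEpiIsStableUnderBaseChange := ⟨fun {_ _ _ _ f g f' g'} sq hg => ?_⟩ }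
      effective := fun R X p₁ p₂ hp => ?_ }
  · rw [MorphismProperty.regularEpi_iff] at hg ⊢
    have hg' : MorphismProperty.regularEpi D (F.map g) := isRegularEpi_map g F
    have : IsRegularEpi (F.map g') :=
      Regular.regularEpiIsStableUnderBaseChange.of_isPullback (sq.map F) hg'
    exact isRegularEpi_of_map F g'
  · obtain ⟨e⟩ := hp.nonempty_equivalenceRelation
    -- A test object of `D` is isomorphic to the image of an object of `C`; fullness and
    -- faithfulness move the question to `C`.
    have : JointlyMono₂ (F.map p₁) (F.map p₂) := ⟨fun Y f g h₁ h₂ => by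
      rw [← cancel_epi (F.objObjPreimageIso Y).hom]
      rw [← F.map_preimage (_ ≫ f), ← F.map_preimage (_ ≫ g)]
      refine congrArg F.map ?_
      refine e.right_cancellation _ _ (F.map_injective ?_) (F.map_injective ?_) <;>
        simp [h₁, h₂]⟩
    have e' : EquivalenceRelation (F.map p₁) (F.map p₂) :=
      { e.toReflexiveRelation.map F, e.toSymmetricRelation.map F,
        e.toTransitiveRelation.map F with }
    obtain ⟨Y, f, hf⟩ := h.effective _ _ e'.isEquivalenceRelation
    refine ⟨F.objPreimage Y, F.preimage (f ≫ (F.objObjPreimageIso Y).inv),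
      IsPullback.of_map_of_faithful (F := F) ?_⟩
    rw [F.map_preimage]
    exact hf.of_iso (Iso.refl _) (Iso.refl _) (Iso.refl _) (F.objObjPreimageIso Y).symm
      (by simp) (by simp) (by simp) (by simp)

/-- The image of a point under a functor. -/
def Pt.mapObj (F : C ⥤ D) {B : C}
    (X : Pt B) : Pt (F.obj B) :=
  ⟨F.obj X.obj, F.map X.proj, F.map X.sect, by rw [← F.map_comp, X.sect_proj, F.map_id]⟩

/-- The image of a morphism of points under a functor. -/
def Pt.mapHom (F : C ⥤ D) {B : C}
    {X Y : Pt B} (f : X ⟶ Y) : X.mapObj F ⟶ Y.mapObj F :=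
  Pt.Hom.mk (F.map f.hom) ((F.map_comp _ _).symm.trans (congrArg F.map f.hom_proj))
    ((F.map_comp _ _).symm.trans (congrArg F.map f.sect_hom))

/-- `F` preserves pullback squares but not the chosen pullbacks, whence the use of the criterion for
arbitrary squares. -/
theorem BournProtomodular.of_equivalence (F : C ⥤ D) [F.IsEquivalence]
    (h : BournProtomodular D) : BournProtomodular C := by
  have : HasPullbacks D := h.choose
  have : HasPullbacks C := Adjunction.hasLimitsOfShape_of_equivalence F
  refine bournProtomodular_iff.2 fun E B p X Y f X' Y' a b a' b' f' hX hY ha hb _ => ?_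
  have : IsIso (F.map f.hom) := bournProtomodular_iff.1 h (F.map p) (Pt.mapHom F f) (F.map a) (F.map b) (F.map a')
    (F.map b') (F.map f') (hX.map F) (hY.map F) ((F.map_comp _ _).symm.trans
      ((congrArg F.map ha).trans (F.map_comp _ _)))
    ((F.map_comp _ _).symm.trans (congrArg F.map hb)) inferInstance
  exact isIso_of_reflects_iso f.hom F

theorem IdeallyExact.of_equivalence [HasCoequalizers D] (F : C ⥤ D) [F.IsEquivalence]
    (h : IdeallyExact D) : IdeallyExact C where
  barrExact := h.barrExact.of_equivalence F
  protomodular := h.protomodular.of_equivalence F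
  hasFiniteCoproducts :=
    have := h.hasFiniteCoproducts
    ⟨fun _ => Adjunction.hasColimitsOfShape_of_equivalence F⟩
  regularEpi I T hI hT := by
    have := h.regularEpi (hI.isInitialObj F) (hT.isTerminalObj F)
    rw [(hI.isInitialObj F).hom_ext ((hI.isInitialObj F).to _) (F.map (hI.to T))] at this
    exact isRegularEpi_of_map F (hI.to T)

end Transport

namespace Variety

open FirstOrder.Language FirstOrder.Language.Structure

variable {V : Variety.{u}}

/-! ### Presentations of concrete categories -/

theorem Presents.ideallyExact {C : Type v} [Category.{w} C] {U : C ⥤ Type u} (h : V.Presents U)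
    (hV : IdeallyExact V.Alg) : IdeallyExact C := by
  obtain ⟨F, _, _⟩ := h
  exact hV.of_equivalence F

/-- A criterion for a category with a faithful set-valued functor to be a given variety: the
underlying sets are algebras of the variety in such a way that the maps that underlie morphisms are
precisely the homomorphisms, and every algebra of the variety arises in this way up to
isomorphism. -/
theorem presents_of {C : Type v} [Category.{w} C] (U : C ⥤ Type u) [U.Faithful]
    (str : ∀ A : C, V.lang.Structure (U.obj A))
    (sat : ∀ A : C, ∀ e ∈ V.identities, ∀ x : ℕ → U.obj A, e.1.realize x = e.2.realize x)
    (map_funMap : ∀ {A B : C} (f : A ⟶ B) (n : ℕ) (g : V.lang.Functions n) (x : Fin n → U.obj A),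
      U.map f (funMap g x) = funMap g fun i => U.map f (x i))
    (full : ∀ (A B : C) (h : U.obj A → U.obj B),
      (∀ (n : ℕ) (g : V.lang.Functions n) (x : Fin n → U.obj A),
        h (funMap g x) = funMap g fun i => h (x i)) → ∃ f : A ⟶ B, ∀ a, U.map f a = h a)
    (surj : ∀ X : V.Alg, ∃ (A : C) (e : U.obj A ≃ X),
      ∀ (n : ℕ) (g : V.lang.Functions n) (x : Fin n → U.obj A),
        e (funMap g x) = funMap g fun i => e (x i)) :
    V.Presents U := by
  let F : C ⥤ V.Alg :=
    { obj := fun A => ⟨U.obj A, sat A⟩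
      map := fun {A B} f => homMk (A := ⟨U.obj A, sat A⟩) (B := ⟨U.obj B, sat B⟩)
        (fun a => U.map f a) (map_funMap f)
      map_id := fun A => alg_hom_ext fun a => congrArg (fun k : U.obj A ⟶ U.obj A => k a)
        (U.map_id A)
      map_comp := fun {A B D} f g => alg_hom_ext fun a =>
        congrArg (fun k : U.obj A ⟶ U.obj D => k a) (U.map_comp f g) }
  have hF {A B : C} (f : A ⟶ B) (a : U.obj A) : F.map f a = U.map f a := rfl
  refine ⟨F, ⟨⟨fun {A B} f g h => U.map_injective ?_⟩, ⟨fun {A B} k => ?_⟩, ⟨fun X => ?_⟩⟩,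
    ⟨NatIso.ofComponents fun A => Iso.refl _⟩⟩
  · ext a
    exact congrArg (fun k : F.obj A ⟶ F.obj B => k a) h
  · obtain ⟨f, hf⟩ := full A B (fun a => k a) fun n g x => hom_map_fun k g x
    exact ⟨f, alg_hom_ext hf⟩
  · obtain ⟨A, e, he⟩ := surj X
    have : IsIso (homMk (A := F.obj A) (B := X) e he) := isIso_of_bijective _ e.bijective
    exact ⟨A, ⟨asIso (homMk (A := F.obj A) (B := X) e he)⟩⟩

end Variety

namespace Variety

open FirstOrder.Language FirstOrder.Language.Structure

/-- The interpretation of the variables that takes given values on the first three of them. -/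
def natVec {M : Type*} (a b c : M) : ℕ → M
  | 0 => a
  | 1 => b
  | _ => c

theorem vec_eta₁ {M : Type*} (x : Fin 1 → M) : ![x 0] = x := by
  ext i
  fin_cases i; rfl

theorem vec_eta₂ {M : Type*} (x : Fin 2 → M) : ![x 0, x 1] = x := by
  ext i
  fin_cases i <;> rfl

/-! ### The variety of Heyting algebras -/

/-- The operations of Heyting algebras. -/
inductive HeytOp : ℕ → Type u
  | inf : HeytOp 2
  | sup : HeytOp 2
  | himp : HeytOp 2
  | top : HeytOp 0
  | bot : HeytOp 0

/-- The signature of Heyting algebras. -/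
def heytLang : FirstOrder.Language.{u, 0} := ⟨HeytOp.{u}, fun _ => Empty⟩

namespace HeytOp

/-- The operation `⊓` on terms. -/
abbrev infTerm {α : Type*} (s t : heytLang.{u}.Term α) : heytLang.{u}.Term α :=
  Functions.apply₂ (L := heytLang.{u}) HeytOp.inf s t

/-- The operation `⊔` on terms. -/
abbrev supTerm {α : Type*} (s t : heytLang.{u}.Term α) : heytLang.{u}.Term α :=
  Functions.apply₂ (L := heytLang.{u}) HeytOp.sup s t

/-- The operation `⇨` on terms. -/
abbrev himpTerm {α : Type*} (s t : heytLang.{u}.Term α) : heytLang.{u}.Term α :=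
  Functions.apply₂ (L := heytLang.{u}) HeytOp.himp s t

/-- The greatest element as a term. -/
abbrev topTerm {α : Type*} : heytLang.{u}.Term α :=
  Constants.term (L := heytLang.{u}) HeytOp.top

/-- The least element as a term. -/
abbrev botTerm {α : Type*} : heytLang.{u}.Term α :=
  Constants.term (L := heytLang.{u}) HeytOp.bot

end HeytOp

open HeytOp in
/-- The identities of Heyting algebras. -/
inductive HeytId : heytLang.{u}.Term ℕ → heytLang.{u}.Term ℕ → Prop
  | sup_comm : HeytId (supTerm (.var 0) (.var 1)) (supTerm (.var 1) (.var 0))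
  | sup_assoc : HeytId (supTerm (supTerm (.var 0) (.var 1)) (.var 2))
      (supTerm (.var 0) (supTerm (.var 1) (.var 2)))
  | inf_comm : HeytId (infTerm (.var 0) (.var 1)) (infTerm (.var 1) (.var 0))
  | inf_assoc : HeytId (infTerm (infTerm (.var 0) (.var 1)) (.var 2))
      (infTerm (.var 0) (infTerm (.var 1) (.var 2)))
  | sup_inf_self : HeytId (supTerm (.var 0) (infTerm (.var 0) (.var 1))) (.var 0)
  | inf_sup_self : HeytId (infTerm (.var 0) (supTerm (.var 0) (.var 1))) (.var 0)
  | inf_top : HeytId (infTerm (.var 0) topTerm) (.var 0)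
  | sup_bot : HeytId (supTerm (.var 0) botTerm) (.var 0)
  | himp_self : HeytId (himpTerm (.var 0) (.var 0)) topTerm
  | inf_himp : HeytId (infTerm (.var 0) (himpTerm (.var 0) (.var 1)))
      (infTerm (.var 0) (.var 1))
  | inf_himp_right : HeytId (infTerm (.var 1) (himpTerm (.var 0) (.var 1))) (.var 1)
  | himp_inf : HeytId (himpTerm (.var 0) (infTerm (.var 1) (.var 2)))
      (infTerm (himpTerm (.var 0) (.var 1)) (himpTerm (.var 0) (.var 2)))

/-- The variety of Heyting algebras. -/
def heytVariety : Variety.{u} where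
  lang := heytLang
  algebraic _ := inferInstanceAs (IsEmpty Empty)
  identities := {p | HeytId p.1 p.2}

/-- Heyting algebras from identities. -/
abbrev heytingAlgebraOfIdentities {X : Type*} [Max X] [Min X] [Top X] [Bot X] [HImp X]
    (sup_comm : ∀ a b : X, a ⊔ b = b ⊔ a) (sup_assoc : ∀ a b c : X, a ⊔ b ⊔ c = a ⊔ (b ⊔ c))
    (inf_comm : ∀ a b : X, a ⊓ b = b ⊓ a) (inf_assoc : ∀ a b c : X, a ⊓ b ⊓ c = a ⊓ (b ⊓ c))
    (sup_inf_self : ∀ a b : X, a ⊔ a ⊓ b = a) (inf_sup_self : ∀ a b : X, a ⊓ (a ⊔ b) = a)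
    (inf_top : ∀ a : X, a ⊓ ⊤ = a) (sup_bot : ∀ a : X, a ⊔ ⊥ = a)
    (himp_self : ∀ a : X, a ⇨ a = ⊤) (inf_himp : ∀ a b : X, a ⊓ (a ⇨ b) = a ⊓ b)
    (inf_himp_right : ∀ a b : X, b ⊓ (a ⇨ b) = b)
    (himp_inf : ∀ a b c : X, a ⇨ b ⊓ c = (a ⇨ b) ⊓ (a ⇨ c)) : HeytingAlgebra X :=
  letI L : Lattice X :=
    Lattice.mk' sup_comm sup_assoc inf_comm inf_assoc sup_inf_self inf_sup_self
  { L with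
    top := ⊤
    le_top := fun a => inf_eq_left.1 (inf_top a)
    bot := ⊥
    bot_le := fun a => sup_eq_left.1 (sup_bot a)
    himp := (· ⇨ ·)
    le_himp_iff := fun a b c => by
      -- As `b ⇨ b = ⊤` and `b ⇨ ·` preserves meets, `b ⇨ a = b ⇨ (b ⊓ a)` and `b ⇨ ·` is monotone.
      -- The adjunction follows from `a ≤ b ⇨ a` and `b ⊓ (b ⇨ c) = b ⊓ c`.
      have hmono (h : b ⊓ a ≤ c) : b ⇨ a ≤ b ⇨ c := by
        have h₁ : (b ⇨ a : X) = b ⇨ (b ⊓ a) := by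
          rw [himp_inf, himp_self, inf_comm ⊤, inf_top]
        rw [h₁, ← inf_eq_left, ← himp_inf, inf_eq_left.2 h]
      refine ⟨fun h => ?_, fun h => le_trans (inf_eq_left.1 (inf_himp_right b a))
        (hmono ((_root_.inf_comm b a).trans_le h))⟩
      refine (inf_le_inf_right b h).trans ?_
      rw [_root_.inf_comm]
      exact (inf_himp b c).trans_le inf_le_right
    compl := fun a => a ⇨ ⊥
    himp_bot := fun _ => rfl }

/-- The operations of a Heyting algebra. -/
abbrev heytStructure (X : Type*) [HeytingAlgebra X] : heytLang.{u}.Structure X where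
  funMap
    | HeytOp.inf, x => x 0 ⊓ x 1
    | HeytOp.sup, x => x 0 ⊔ x 1
    | HeytOp.himp, x => x 0 ⇨ x 1
    | HeytOp.top, _ => ⊤
    | HeytOp.bot, _ => ⊥
  RelMap _ _ := False

theorem HeytId.realize_eq {X : Type*} [HeytingAlgebra X] {s t : heytLang.{u}.Term ℕ}
    (h : HeytId s t) (x : ℕ → X) :
    let _ := heytStructure.{u} X
    s.realize x = t.realize x := by
  cases h
  · exact _root_.sup_comm (x 0) (x 1)
  · exact _root_.sup_assoc (x 0) (x 1) (x 2)
  · exact _root_.inf_comm (x 0) (x 1)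
  · exact _root_.inf_assoc (x 0) (x 1) (x 2)
  · exact _root_.sup_inf_self (a := x 0) (b := x 1)
  · exact _root_.inf_sup_self (a := x 0) (b := x 1)
  · exact inf_top_eq (x 0)
  · exact sup_bot_eq (x 0)
  · exact _root_.himp_self (a := x 0)
  · exact _root_.inf_himp (x 0) (x 1)
  · exact inf_eq_left.2 (le_himp (a := x 1) (b := x 0))
  · exact himp_inf_distrib (x 0) (x 1) (x 2)

section

/-- The signature of `heytVariety` unfolds to `heytLang`; this instance lets terms written over
`heytLang` be evaluated in its algebras. -/
instance (A : heytVariety.{u}.Alg) : heytLang.{u}.Structure A := A.str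

variable (A : heytVariety.{u}.Alg)

/-- The binary operations of an algebra of the variety of Heyting algebras. -/
def heytOp₂ (f : HeytOp.{u} 2) (a b : A) : A := funMap (L := heytLang.{u}) f ![a, b]

/-- The constants of an algebra of the variety of Heyting algebras. -/
def heytOp₀ (f : HeytOp.{u} 0) : A := funMap (L := heytLang.{u}) f default

theorem realize_heytOp₂ {α : Type*} (f : HeytOp.{u} 2) (s t : heytLang.{u}.Term α) (x : α → A) :
    (Functions.apply₂ (L := heytLang.{u}) f s t).realize x =
      heytOp₂ A f (s.realize x) (t.realize x) :=
  Term.realize_functions_apply₂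

theorem realize_heytOp₀ {α : Type*} (f : HeytOp.{u} 0) (x : α → A) :
    (Constants.term (L := heytLang.{u}) f).realize x = heytOp₀ A f :=
  Term.realize_constants

/-- The algebras of the variety of Heyting algebras are Heyting algebras. -/
abbrev heytingAlgebraOfAlg : HeytingAlgebra A :=
  letI : Max A := ⟨heytOp₂ A .sup⟩
  letI : Min A := ⟨heytOp₂ A .inf⟩
  letI : HImp A := ⟨heytOp₂ A .himp⟩
  letI : Top A := ⟨heytOp₀ A .top⟩
  letI : Bot A := ⟨heytOp₀ A .bot⟩
  have key {s t : heytLang.{u}.Term ℕ} (h : HeytId s t) (a b c : A) :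
      Term.realize (L := heytLang.{u}) (natVec a b c) s =
        Term.realize (L := heytLang.{u}) (natVec a b c) t := A.sat (s, t) h _
  heytingAlgebraOfIdentities
    (fun a b => by
      have := key .sup_comm a b b
      simp only [realize_heytOp₂] at this
      exact this)
    (fun a b c => by
      have := key .sup_assoc a b c
      simp only [realize_heytOp₂] at this
      exact this)
    (fun a b => by
      have := key .inf_comm a b b
      simp only [realize_heytOp₂] at this
      exact this)
    (fun a b c => by
      have := key .inf_assoc a b c
      simp only [realize_heytOp₂] at this
      exact this)
    (fun a b => by
      have := key .sup_inf_self a b b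
      simp only [realize_heytOp₂] at this
      exact this)
    (fun a b => by
      have := key .inf_sup_self a b b
      simp only [realize_heytOp₂] at this
      exact this)
    (fun a => by
      have := key .inf_top a a a
      simp only [realize_heytOp₂, realize_heytOp₀] at this
      exact this)
    (fun a => by
      have := key .sup_bot a a a
      simp only [realize_heytOp₂, realize_heytOp₀] at this
      exact this)
    (fun a => by
      have := key .himp_self a a a
      simp only [realize_heytOp₂, realize_heytOp₀] at this
      exact this)
    (fun a b => by
      have := key .inf_himp a b b
      simp only [realize_heytOp₂] at this
      exact this)
    (fun a b => by
      have := key .inf_himp_right a b b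
      simp only [realize_heytOp₂] at this
      exact this)
    (fun a b c => by
      have := key .himp_inf a b c
      simp only [realize_heytOp₂] at this
      exact this)

end

theorem heytVariety_presents : heytVariety.{u}.Presents (forget HeytAlg.{u}) := by
  refine presents_of _ (fun A => heytStructure A.carrier) (fun A e he x => HeytId.realize_eq he x)
    (fun {A B} f n g x => ?_) (fun A B h hh => ?_) fun X => ?_
  · cases g
    · exact map_inf f.hom (x 0) (x 1)
    · exact map_sup f.hom (x 0) (x 1)
    · exact map_himp f.hom (x 0) (x 1)
    · exact map_top f.hom
    · exact map_bot f.hom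
  · exact ⟨HeytAlg.ofHom
      { toFun := h
        map_sup' := fun a b => hh 2 HeytOp.sup ![a, b]
        map_inf' := fun a b => hh 2 HeytOp.inf ![a, b]
        map_bot' := hh 0 HeytOp.bot default
        map_himp' := fun a b => hh 2 HeytOp.himp ![a, b] }, fun _ => rfl⟩
  · let _ := heytingAlgebraOfAlg X
    refine ⟨HeytAlg.of X, Equiv.refl _, fun n g x => ?_⟩
    cases g
    · exact congrArg (funMap (L := heytLang.{u}) HeytOp.inf) (vec_eta₂ x)
    · exact congrArg (funMap (L := heytLang.{u}) HeytOp.sup) (vec_eta₂ x)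
    · exact congrArg (funMap (L := heytLang.{u}) HeytOp.himp) (vec_eta₂ x)
    · exact congrArg (funMap (L := heytLang.{u}) HeytOp.top) (Subsingleton.elim _ _)
    · exact congrArg (funMap (L := heytLang.{u}) HeytOp.bot) (Subsingleton.elim _ _)

open HeytOp in
/-- Protomodular terms for Heyting algebras. -/
def heytTerms : heytVariety.{u}.ProtomodularTerms 2 where
  e _ := topTerm
  d := ![himpTerm (.var 1) (.var 0),
    himpTerm (himpTerm (himpTerm (.var 1) (.var 0)) (.var 0)) (.var 1)]
  t := infTerm (himpTerm (.var 1) (.var 0)) (.var 2)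
  t_eq A x y := by
    let _ := heytingAlgebraOfAlg A
    have h₁ : Term.realize (L := heytLang.{u}) ![x, y] (himpTerm (.var 1) (.var 0)) = y ⇨ x :=
      realize_heytOp₂ A _ _ _ _
    have h₂ : Term.realize (L := heytLang.{u}) ![x, y]
        (himpTerm (himpTerm (himpTerm (.var 1) (.var 0)) (.var 0)) (.var 1)) =
          ((y ⇨ x) ⇨ x) ⇨ y := by
      simp only [realize_heytOp₂]
      rfl
    refine (realize_heytOp₂ A _ _ _ _).trans ?_
    rw [realize_heytOp₂]
    change (Term.realize (L := heytLang.{u}) ![x, y] (himpTerm (.var 1) (.var 0)) ⇨ x) ⊓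
      Term.realize (L := heytLang.{u}) ![x, y]
        (himpTerm (himpTerm (himpTerm (.var 1) (.var 0)) (.var 0)) (.var 1)) = y
    -- With `c = (y ⇨ x) ⇨ x`, the left side is `c ⊓ (c ⇨ y) = c ⊓ y`, and `y ≤ c`.
    rw [h₁, h₂, inf_himp, inf_eq_right]
    exact le_himp_himp
  d_eq A x k := by
    let _ := heytingAlgebraOfAlg A
    refine Eq.trans ?_ (realize_heytOp₀ A _ _).symm
    fin_cases k
    · refine (realize_heytOp₂ A _ _ _ _).trans ?_
      exact himp_self (a := x)
    · refine (realize_heytOp₂ A _ _ _ _).trans ?_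
      simp only [realize_heytOp₂]
      change (((x ⇨ x) ⇨ x) ⇨ x) = ⊤
      rw [himp_self, top_himp, himp_self]

theorem heytTerms_constantsAgree : heytTerms.{u}.ConstantsAgree := fun _ _ _ => rfl

end Variety

theorem ideallyExact_heytAlg : IdeallyExact HeytAlg.{u} :=
  Variety.heytVariety_presents.ideallyExact Variety.heytTerms.ideallyExact

/-- A morphism from the one-element algebra forces `⊥ = ⊤` in a zero object, and a morphism on to a
two-element algebra then contradicts `⊥ ≠ ⊤`. -/
theorem not_hasZeroObject_heytAlg : ¬ HasZeroObject HeytAlg.{u} := by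
  rintro ⟨Z, hZ⟩
  let f := (hZ.from_ (HeytAlg.of PUnit.{u + 1})).hom
  let g := (hZ.to_ (HeytAlg.of (Set PUnit.{u + 1}))).hom
  have h : g ⊥ = g ⊤ := by
    rw [← map_bot f, ← map_top f]
  exact bot_ne_top ((map_bot g).symm.trans (h.trans (map_top g)))

namespace Variety

open FirstOrder.Language FirstOrder.Language.Structure

/-! ### Varieties of unital algebras over a commutative ring -/

/-- The operations of unital algebras over `K`. -/
inductive AlgOp (K : Type u) : ℕ → Type u
  | add : AlgOp K 2
  | mul : AlgOp K 2
  | neg : AlgOp K 1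
  | smul (r : K) : AlgOp K 1
  | zero : AlgOp K 0
  | one : AlgOp K 0

/-- The signature of unital algebras over `K`. -/
def algLang (K : Type u) : FirstOrder.Language.{u, 0} := ⟨AlgOp K, fun _ => Empty⟩

namespace AlgOp

variable {K : Type u} {α : Type*}

/-- Addition of terms. -/
abbrev addTerm (s t : (algLang K).Term α) : (algLang K).Term α :=
  Functions.apply₂ (L := algLang K) AlgOp.add s t

/-- Multiplication of terms. -/
abbrev mulTerm (s t : (algLang K).Term α) : (algLang K).Term α :=
  Functions.apply₂ (L := algLang K) AlgOp.mul s t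

/-- Negation of terms. -/
abbrev negTerm (t : (algLang K).Term α) : (algLang K).Term α :=
  Functions.apply₁ (L := algLang K) AlgOp.neg t

/-- Scalar multiplication of terms. -/
abbrev smulTerm (r : K) (t : (algLang K).Term α) : (algLang K).Term α :=
  Functions.apply₁ (L := algLang K) (AlgOp.smul r) t

/-- Zero as a term. -/
abbrev zeroTerm : (algLang K).Term α := Constants.term (L := algLang K) AlgOp.zero

/-- The unit as a term. -/
abbrev oneTerm : (algLang K).Term α := Constants.term (L := algLang K) AlgOp.one

end AlgOp

open AlgOp in
/-- The identities of unital algebras over `K`, with associativity if `P` holds. -/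
inductive AlgId (K : Type u) [CommRing K] (P : Prop) :
    (algLang K).Term ℕ → (algLang K).Term ℕ → Prop
  | add_assoc : AlgId K P (addTerm (addTerm (.var 0) (.var 1)) (.var 2))
      (addTerm (.var 0) (addTerm (.var 1) (.var 2)))
  | zero_add : AlgId K P (addTerm zeroTerm (.var 0)) (.var 0)
  | neg_add_cancel : AlgId K P (addTerm (negTerm (.var 0)) (.var 0)) zeroTerm
  | add_comm : AlgId K P (addTerm (.var 0) (.var 1)) (addTerm (.var 1) (.var 0))
  | left_distrib : AlgId K P (mulTerm (.var 0) (addTerm (.var 1) (.var 2)))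
      (addTerm (mulTerm (.var 0) (.var 1)) (mulTerm (.var 0) (.var 2)))
  | right_distrib : AlgId K P (mulTerm (addTerm (.var 0) (.var 1)) (.var 2))
      (addTerm (mulTerm (.var 0) (.var 2)) (mulTerm (.var 1) (.var 2)))
  | zero_mul : AlgId K P (mulTerm zeroTerm (.var 0)) zeroTerm
  | mul_zero : AlgId K P (mulTerm (.var 0) zeroTerm) zeroTerm
  | one_mul : AlgId K P (mulTerm oneTerm (.var 0)) (.var 0)
  | mul_one : AlgId K P (mulTerm (.var 0) oneTerm) (.var 0)
  | smul_add (r : K) : AlgId K P (smulTerm r (addTerm (.var 0) (.var 1)))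
      (addTerm (smulTerm r (.var 0)) (smulTerm r (.var 1)))
  | add_smul (r s : K) : AlgId K P (smulTerm (r + s) (.var 0))
      (addTerm (smulTerm r (.var 0)) (smulTerm s (.var 0)))
  | mul_smul (r s : K) : AlgId K P (smulTerm (r * s) (.var 0)) (smulTerm r (smulTerm s (.var 0)))
  | one_smul : AlgId K P (smulTerm 1 (.var 0)) (.var 0)
  | smul_mul (r : K) : AlgId K P (mulTerm (smulTerm r (.var 0)) (.var 1))
      (smulTerm r (mulTerm (.var 0) (.var 1)))
  | mul_smul_comm (r : K) : AlgId K P (mulTerm (.var 0) (smulTerm r (.var 1)))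
      (smulTerm r (mulTerm (.var 0) (.var 1)))
  | mul_assoc (h : P) : AlgId K P (mulTerm (mulTerm (.var 0) (.var 1)) (.var 2))
      (mulTerm (.var 0) (mulTerm (.var 1) (.var 2)))

/-- The variety of unital algebras over `K`, which are associative if `P` holds. -/
def algVariety (K : Type u) [CommRing K] (P : Prop) : Variety.{u} where
  lang := algLang K
  algebraic _ := inferInstanceAs (IsEmpty Empty)
  identities := {p | AlgId K P p.1 p.2}

section

variable (K : Type u) [CommRing K]

/-- The operations of a unital algebra. -/
abbrev algStructure (X : Type*) [NonAssocRing X] [Module K X] : (algLang K).Structure X where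
  funMap
    | AlgOp.add, x => x 0 + x 1
    | AlgOp.mul, x => x 0 * x 1
    | AlgOp.neg, x => -x 0
    | AlgOp.smul r, x => r • x 0
    | AlgOp.zero, _ => 0
    | AlgOp.one, _ => 1
  RelMap _ _ := False

variable {K}

theorem AlgId.realize_eq {P : Prop} {X : Type*} [NonAssocRing X] [Module K X]
    [IsScalarTower K X X] [SMulCommClass K X X] (hP : P → ∀ a b c : X, a * b * c = a * (b * c))
    {s t : (algLang K).Term ℕ} (h : AlgId K P s t) (x : ℕ → X) :
    let _ := algStructure K X
    s.realize x = t.realize x := by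
  cases h with
  | add_assoc => exact _root_.add_assoc (x 0) (x 1) (x 2)
  | zero_add => exact _root_.zero_add (x 0)
  | neg_add_cancel => exact _root_.neg_add_cancel (x 0)
  | add_comm => exact _root_.add_comm (x 0) (x 1)
  | left_distrib => exact mul_add (x 0) (x 1) (x 2)
  | right_distrib => exact add_mul (x 0) (x 1) (x 2)
  | zero_mul => exact MulZeroClass.zero_mul (x 0)
  | mul_zero => exact MulZeroClass.mul_zero (x 0)
  | one_mul => exact _root_.one_mul (x 0)
  | mul_one => exact _root_.mul_one (x 0)
  | smul_add r => exact _root_.smul_add r (x 0) (x 1)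
  | add_smul r s => exact _root_.add_smul r s (x 0)
  | mul_smul r s => exact SemigroupAction.mul_smul r s (x 0)
  | one_smul => exact _root_.one_smul K (x 0)
  | smul_mul r => exact smul_mul_assoc r (x 0) (x 1)
  | mul_smul_comm r => exact _root_.mul_smul_comm r (x 0) (x 1)
  | mul_assoc h => exact hP h (x 0) (x 1) (x 2)

variable {P : Prop}

instance (A : (algVariety K P).Alg) : (algLang K).Structure A := A.str

variable (A : (algVariety K P).Alg)

/-- The binary operations of an algebra of the variety of unital algebras. -/
def algOp₂ (f : AlgOp K 2) (a b : A) : A := funMap (L := algLang K) f ![a, b]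

/-- The unary operations of an algebra of the variety of unital algebras. -/
def algOp₁ (f : AlgOp K 1) (a : A) : A := funMap (L := algLang K) f ![a]

/-- The constants of an algebra of the variety of unital algebras. -/
def algOp₀ (f : AlgOp K 0) : A := funMap (L := algLang K) f default

theorem realize_algOp₂ {α : Type*} (f : AlgOp K 2) (s t : (algLang K).Term α) (x : α → A) :
    (Functions.apply₂ (L := algLang K) f s t).realize x =
      algOp₂ A f (s.realize x) (t.realize x) :=
  Term.realize_functions_apply₂

theorem realize_algOp₁ {α : Type*} (f : AlgOp K 1) (t : (algLang K).Term α) (x : α → A) :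
    (Functions.apply₁ (L := algLang K) f t).realize x = algOp₁ A f (t.realize x) :=
  Term.realize_functions_apply₁

theorem realize_algOp₀ {α : Type*} (f : AlgOp K 0) (x : α → A) :
    (Constants.term (L := algLang K) f).realize x = algOp₀ A f :=
  Term.realize_constants

variable {A} in
theorem AlgId.realize_natVec {s t : (algLang K).Term ℕ} (h : AlgId K P s t) (a b c : A) :
    Term.realize (L := algLang K) (natVec a b c) s =
      Term.realize (L := algLang K) (natVec a b c) t :=
  A.sat (s, t) h _

/-- The ring structure on an algebra of the variety of unital algebras. -/
abbrev nonAssocRingOfAlg : NonAssocRing A :=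
  letI : Add A := ⟨algOp₂ A .add⟩
  letI : Mul A := ⟨algOp₂ A .mul⟩
  letI : Neg A := ⟨algOp₁ A .neg⟩
  letI : Zero A := ⟨algOp₀ A .zero⟩
  letI : One A := ⟨algOp₀ A .one⟩
  have zero_add (a : A) : 0 + a = a := by
    have := AlgId.zero_add.realize_natVec a a a
    simp only [realize_algOp₂, realize_algOp₀] at this
    exact this
  have add_comm (a b : A) : a + b = b + a := by
    have := AlgId.add_comm.realize_natVec a b b
    simp only [realize_algOp₂] at this
    exact this
  { add_assoc := fun a b c => by
      have := AlgId.add_assoc.realize_natVec a b c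
      simp only [realize_algOp₂] at this
      exact this
    zero_add := zero_add
    add_zero := fun a => (add_comm a 0).trans (zero_add a)
    nsmul := nsmulRec
    zsmul := zsmulRec
    neg_add_cancel := fun a => by
      have := AlgId.neg_add_cancel.realize_natVec a a a
      simp only [realize_algOp₂, realize_algOp₁, realize_algOp₀] at this
      exact this
    add_comm := add_comm
    left_distrib := fun a b c => by
      have := AlgId.left_distrib.realize_natVec a b c
      simp only [realize_algOp₂] at this
      exact this
    right_distrib := fun a b c => by
      have := AlgId.right_distrib.realize_natVec a b c
      simp only [realize_algOp₂] at this
      exact this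
    zero_mul := fun a => by
      have := AlgId.zero_mul.realize_natVec a a a
      simp only [realize_algOp₂, realize_algOp₀] at this
      exact this
    mul_zero := fun a => by
      have := AlgId.mul_zero.realize_natVec a a a
      simp only [realize_algOp₂, realize_algOp₀] at this
      exact this
    one_mul := fun a => by
      have := AlgId.one_mul.realize_natVec a a a
      simp only [realize_algOp₂, realize_algOp₀] at this
      exact this
    mul_one := fun a => by
      have := AlgId.mul_one.realize_natVec a a a
      simp only [realize_algOp₂, realize_algOp₀] at this
      exact this }

attribute [local instance] nonAssocRingOfAlg

/-- The module structure on an algebra of the variety of unital algebras. -/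
abbrev moduleOfAlg : Module K A :=
  letI : SMul K A := ⟨fun r => algOp₁ A (.smul r)⟩
  Module.ofMinimalAxioms
    (fun r a b => by
      have := (AlgId.smul_add r).realize_natVec a b b
      simp only [realize_algOp₁, realize_algOp₂] at this
      exact this)
    (fun r s a => by
      have := (AlgId.add_smul r s).realize_natVec a a a
      simp only [realize_algOp₁, realize_algOp₂] at this
      exact this)
    (fun r s a => by
      have := (AlgId.mul_smul r s).realize_natVec a a a
      simp only [realize_algOp₁] at this
      exact this)
    (fun a => by
      have := AlgId.one_smul.realize_natVec a a a
      simp only [realize_algOp₁] at this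
      exact this)

attribute [local instance] moduleOfAlg

theorem smul_mul_of_alg (r : K) (a b : A) : (r • a) * b = r • (a * b) := by
  have := (AlgId.smul_mul r).realize_natVec a b b
  simp only [realize_algOp₁, realize_algOp₂] at this
  exact this

theorem mul_smul_of_alg (r : K) (a b : A) : a * (r • b) = r • (a * b) := by
  have := (AlgId.mul_smul_comm r).realize_natVec a b b
  simp only [realize_algOp₁, realize_algOp₂] at this
  exact this

/-- The ring structure on an algebra of the variety of associative unital algebras. -/
abbrev ringOfAlg (hP : P) : Ring A :=
  { nonAssocRingOfAlg A with
    mul_assoc := fun a b c => by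
      have := (AlgId.mul_assoc hP).realize_natVec a b c
      simp only [realize_algOp₂] at this
      exact this }

/-- The algebra structure on an algebra of the variety of associative unital algebras. -/
abbrev algebraOfAlg (hP : P) :
    letI := ringOfAlg A hP
    Algebra K A :=
  letI := ringOfAlg A hP
  Algebra.ofModule (smul_mul_of_alg A) (fun r a b => mul_smul_of_alg A r a b)

/-- The operations given by the ring and module structures are the original ones. -/
theorem algStructure_funMap (n : ℕ) (g : (algLang K).Functions n) (x : Fin n → A) :
    (algStructure K A).funMap g x = A.str.funMap g x := by
  cases g with
  | add => exact congrArg (funMap (L := algLang K) AlgOp.add) (vec_eta₂ x)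
  | mul => exact congrArg (funMap (L := algLang K) AlgOp.mul) (vec_eta₂ x)
  | neg => exact congrArg (funMap (L := algLang K) AlgOp.neg) (vec_eta₁ x)
  | smul r => exact congrArg (funMap (L := algLang K) (AlgOp.smul r)) (vec_eta₁ x)
  | zero =>
    exact congrArg (funMap (L := algLang K) (M := A) AlgOp.zero) (Subsingleton.elim default x)
  | one =>
    exact congrArg (funMap (L := algLang K) (M := A) AlgOp.one) (Subsingleton.elim default x)

variable (K P) in
open AlgOp in
/-- Protomodular terms for unital algebras. -/
def algTerms : (algVariety K P).ProtomodularTerms 1 :=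
  .ofOne (V := algVariety K P) zeroTerm (addTerm (.var 1) (negTerm (.var 0)))
    (addTerm (.var 1) (.var 0))
    (fun A x y => by
      refine (realize_algOp₂ A _ _ _ _).trans ?_
      have h : Term.realize (L := algLang K) ![x, y] (addTerm (.var 1) (negTerm (.var 0))) =
          y + -x := by
        simp only [realize_algOp₂, realize_algOp₁]
        rfl
      change Term.realize (L := algLang K) ![x, y] (addTerm (.var 1) (negTerm (.var 0))) + x = y
      rw [h, neg_add_cancel_right])
    (fun A x => by
      refine Eq.trans ?_ (realize_algOp₀ A _ _).symm
      refine (realize_algOp₂ A _ _ _ _).trans ?_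
      rw [realize_algOp₁]
      exact add_neg_cancel x)

end

/-! ### Concrete categories of algebras -/

theorem algVariety_presents_nonAssocAlgCat (R : Type u) [CommRing R] :
    (algVariety R False).Presents (forget (NonAssocAlgCat.{u} R)) := by
  refine presents_of _ (fun A => algStructure R A.carrier)
    (fun A e he x => AlgId.realize_eq False.elim he x)
    (fun {A B} f n g x => ?_) (fun A B h hh => ?_) fun X => ?_
  · cases g with
    | add => exact f.hom.map_add (x 0) (x 1)
    | mul => exact f.hom.map_mul' (x 0) (x 1)
    | neg => exact map_neg f.hom.toLinearMap (x 0)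
    | smul r => exact f.hom.map_smul r (x 0)
    | zero => exact map_zero f.hom.toLinearMap
    | one => exact f.hom.map_one'
  · exact ⟨⟨
      { toFun := h
        map_add' := fun a b => hh 2 AlgOp.add ![a, b]
        map_smul' := fun r a => hh 1 (AlgOp.smul r) ![a]
        map_one' := hh 0 AlgOp.one default
        map_mul' := fun a b => hh 2 AlgOp.mul ![a, b] }⟩, fun _ => rfl⟩
  · let _ := nonAssocRingOfAlg X
    let _ := moduleOfAlg X
    have : IsScalarTower R X X := ⟨smul_mul_of_alg X⟩
    have : SMulCommClass R X X := ⟨fun r a b => (mul_smul_of_alg X r a b).symm⟩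
    exact ⟨⟨X.carrier⟩, Equiv.refl _, algStructure_funMap X⟩

theorem algVariety_presents_algCat (R : Type u) [CommRing R] :
    (algVariety R True).Presents (forget (AlgCat.{u} R)) := by
  refine presents_of _ (fun A => algStructure R A.carrier)
    (fun A e he x => AlgId.realize_eq (fun _ => mul_assoc) he x)
    (fun {A B} f n g x => ?_) (fun A B h hh => ?_) fun X => ?_
  · cases g with
    | add => exact map_add f.hom (x 0) (x 1)
    | mul => exact map_mul f.hom (x 0) (x 1)
    | neg => exact map_neg f.hom (x 0)
    | smul r => exact map_smul f.hom r (x 0)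
    | zero => exact map_zero f.hom
    | one => exact map_one f.hom
  · let k : A.carrier →ₗ[R] B.carrier :=
      { toFun := h
        map_add' := fun a b => hh 2 AlgOp.add ![a, b]
        map_smul' := fun r a => hh 1 (AlgOp.smul r) ![a] }
    exact ⟨AlgCat.ofHom (AlgHom.ofLinearMap k (hh 0 AlgOp.one default)
      fun a b => hh 2 AlgOp.mul ![a, b]), fun _ => rfl⟩
  · let _ := ringOfAlg X trivial
    let _ := algebraOfAlg X trivial
    exact ⟨AlgCat.of R X.carrier, Equiv.refl _, algStructure_funMap X⟩

/-- Unital rings are associative algebras over the integers, lifted to the universe `u`. -/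
theorem algVariety_presents_ringCat :
    (algVariety (ULift.{u} ℤ) True).Presents (forget RingCat.{u}) := by
  -- An abelian group has only one module structure over the integers, so the scalar operations of
  -- an algebra are determined by its ring structure.
  have smul_def (M : Type u) [AddCommGroup M] (i : Module (ULift.{u} ℤ) M) (r : ULift.{u} ℤ)
      (a : M) : i.smul r a = r.down • a := by
    let j : Module ℤ M := Module.compHom M (ULift.ringEquiv.{0, u} (R := ℤ)).symm.toRingHom
    exact int_smul_eq_zsmul j r.down a
  refine presents_of _ (fun A => algStructure (ULift.{u} ℤ) A.carrier)
    (fun A e he x => ?_) (fun {A B} f n g x => ?_) (fun A B h hh => ?_) fun X => ?_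
  · have : SMulCommClass (ULift.{u} ℤ) A.carrier A.carrier :=
      ⟨fun r a b => smul_comm r.down a b⟩
    exact AlgId.realize_eq (X := A.carrier) (fun _ => mul_assoc) he x
  · cases g with
    | add => exact map_add f.hom (x 0) (x 1)
    | mul => exact map_mul f.hom (x 0) (x 1)
    | neg => exact map_neg f.hom (x 0)
    | smul r => exact map_zsmul f.hom r.down (x 0)
    | zero => exact map_zero f.hom
    | one => exact map_one f.hom
  · exact ⟨RingCat.ofHom
      { toFun := h
        map_add' := fun a b => hh 2 AlgOp.add ![a, b]
        map_zero' := hh 0 AlgOp.zero default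
        map_one' := hh 0 AlgOp.one default
        map_mul' := fun a b => hh 2 AlgOp.mul ![a, b] }, fun _ => rfl⟩
  · let _ := ringOfAlg X trivial
    refine ⟨RingCat.of X.carrier, Equiv.refl _, fun n g x => Eq.trans ?_
      (algStructure_funMap X n g x)⟩
    cases g with
    | smul r => exact (smul_def X (moduleOfAlg X) r (x 0)).symm
    | _ => rfl

end Variety

/-! ### Unital rings and algebras: ideally exact but not pointed -/

theorem ideallyExact_ringCat : IdeallyExact RingCat.{u} :=
  Variety.algVariety_presents_ringCat.ideallyExact (Variety.algTerms _ _).ideallyExact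

theorem ideallyExact_algCat (R : Type u) [CommRing R] : IdeallyExact (AlgCat.{u} R) :=
  (Variety.algVariety_presents_algCat R).ideallyExact (Variety.algTerms _ _).ideallyExact

theorem ideallyExact_nonAssocAlgCat (R : Type u) [CommRing R] :
    IdeallyExact (NonAssocAlgCat.{u} R) :=
  (Variety.algVariety_presents_nonAssocAlgCat R).ideallyExact (Variety.algTerms _ _).ideallyExact

/-- A morphism from the zero ring forces `0 = 1` in a zero object, which then cannot map to a ring
with `0 ≠ 1`. Over `R`, the nontrivial target is `R` itself. -/
theorem not_hasZeroObject_ringCat : ¬ HasZeroObject RingCat.{u} := by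
  rintro ⟨Z, hZ⟩
  let f := (hZ.from_ (RingCat.of PUnit.{u + 1})).hom
  let g := (hZ.to_ (RingCat.of (ULift.{u} ℤ))).hom
  have h : g 0 = g 1 := by
    rw [← map_zero f, ← map_one f]
  exact zero_ne_one ((map_zero g).symm.trans (h.trans (map_one g)))

theorem not_hasZeroObject_algCat (R : Type u) [CommRing R] [Nontrivial R] :
    ¬ HasZeroObject (AlgCat.{u} R) := by
  rintro ⟨Z, hZ⟩
  let f := (hZ.from_ (AlgCat.of R PUnit.{u + 1})).hom
  let g := (hZ.to_ (AlgCat.of R R)).hom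
  have h : g 0 = g 1 := by
    rw [← map_zero f, ← map_one f]
  exact zero_ne_one ((map_zero g).symm.trans (h.trans (map_one g)))

theorem not_hasZeroObject_nonAssocAlgCat (R : Type u) [CommRing R] [Nontrivial R] :
    ¬ HasZeroObject (NonAssocAlgCat.{u} R) := by
  rintro ⟨Z, hZ⟩
  let f := (hZ.from_ (⟨PUnit.{u + 1}⟩ : NonAssocAlgCat R)).hom
  let g := (hZ.to_ (⟨R⟩ : NonAssocAlgCat R)).hom
  have h : (0 : Z.carrier) = 1 := (map_zero f.toLinearMap).symm.trans f.map_one'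
  exact zero_ne_one (((map_zero g.toLinearMap).symm.trans (congrArg g.toLinearMap h)).trans
    g.map_one')

theorem mainTheorem8 :
    -- the term characterization of Bourn protomodular varieties
    (∀ V : Variety.{u},
      BournProtomodular V.Alg ↔ ∃ n : ℕ, Nonempty (V.ProtomodularTerms n)) ∧
    -- non-trivial varieties: ideally exact = Bourn protomodular
    (∀ V : Variety.{u}, ¬ V.AtMostOneElement →
      (IdeallyExact V.Alg ↔ BournProtomodular V.Alg)) ∧
    -- the pointed case
    (∀ (V : Variety.{u}) (n : ℕ) (T : V.ProtomodularTerms n),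
      (HasZeroObject V.Alg ↔ SemiAbelian V.Alg) ∧
      (HasZeroObject V.Alg → T.ConstantsAgree)) ∧
    -- Heyting algebras
    ((∃ V : Variety.{u}, V.Presents (forget HeytAlg.{u}) ∧
        ∃ T : V.ProtomodularTerms 2, T.ConstantsAgree) ∧
      IdeallyExact HeytAlg.{u} ∧ ¬ HasZeroObject HeytAlg.{u}) ∧
    -- groups and loops with arbitrary additional structure
    (∀ V : Variety.{u}, Nonempty V.LoopTerms ∨ Nonempty V.GroupTerms →
      Nonempty (V.ProtomodularTerms 1) ∧ IdeallyExact V.Alg) ∧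
    -- groups with multiple operators
    (∀ V : Variety.{u}, V.IsGroupsWithMultipleOperators →
      Nonempty (V.ProtomodularTerms 1) ∧ HasZeroObject V.Alg ∧
      SemiAbelian V.Alg ∧ IdeallyExact V.Alg) ∧
    -- unital rings
    ((∃ V : Variety.{u}, V.Presents (forget RingCat.{u}) ∧
        Nonempty (V.ProtomodularTerms 1)) ∧
      IdeallyExact RingCat.{u} ∧ ¬ HasZeroObject RingCat.{u}) ∧
    -- unital associative algebras over a commutative ring
    (∀ (R : Type u) [CommRing R],
      (∃ V : Variety.{u}, V.Presents (forget (AlgCat.{u} R)) ∧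
        Nonempty (V.ProtomodularTerms 1)) ∧
      IdeallyExact (AlgCat.{u} R) ∧
      (Nontrivial R → ¬ HasZeroObject (AlgCat.{u} R))) ∧
    -- unital, not necessarily associative algebras over a commutative ring
    (∀ (R : Type u) [CommRing R],
      (∃ V : Variety.{u}, V.Presents (forget (NonAssocAlgCat.{u} R)) ∧
        Nonempty (V.ProtomodularTerms 1)) ∧
      IdeallyExact (NonAssocAlgCat.{u} R) ∧
      (Nontrivial R → ¬ HasZeroObject (NonAssocAlgCat.{u} R))) ∧
    -- the case `n = 0`
    (∀ V : Variety.{u}, Nonempty (V.ProtomodularTerms 0) ↔ V.AtMostOneElement) ∧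
    (∃ V : Variety.{u}, V.AtMostOneElement ∧ V.ContainsEmpty) ∧
    (∃ V : Variety.{u}, V.AtMostOneElement ∧ ¬ V.ContainsEmpty) ∧
    (∀ V W : Variety.{u}, V.AtMostOneElement → W.AtMostOneElement →
      (Nonempty (V.Alg ≌ W.Alg) ↔ (V.ContainsEmpty ↔ W.ContainsEmpty))) ∧
    (∀ V : Variety.{u}, V.AtMostOneElement →
      BournProtomodular V.Alg ∧ (IdeallyExact V.Alg ↔ ¬ V.ContainsEmpty)) ∧
    -- lattices viewed as categories
    (∀ (P : Type w) [Lattice P],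
      ((∃ a : P, IsTop a) → BarrExact P) ∧ BournProtomodular P ∧
      (IdeallyExact P ↔ ∃ a : P, ∀ b : P, b = a)) := by
  refine ⟨fun V => Variety.bournProtomodular_iff_exists_terms,
    fun V => Variety.ideallyExact_iff_of_not_atMostOneElement,
    fun V n T => ⟨T.semiAbelian_iff,
      fun h A j k => Variety.const_eq_of_hasZeroObject h A (T.e j) (T.e k)⟩,
    ⟨⟨_, Variety.heytVariety_presents, _, Variety.heytTerms_constantsAgree⟩,
      ideallyExact_heytAlg, not_hasZeroObject_heytAlg⟩,
    ?_, fun V hV => ?_,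
    ⟨⟨_, Variety.algVariety_presents_ringCat, ⟨Variety.algTerms _ _⟩⟩,
      ideallyExact_ringCat, not_hasZeroObject_ringCat⟩,
    fun R _ => ⟨⟨_, Variety.algVariety_presents_algCat R, ⟨Variety.algTerms _ _⟩⟩,
      ideallyExact_algCat R, fun _ => not_hasZeroObject_algCat R⟩,
    fun R _ => ⟨⟨_, Variety.algVariety_presents_nonAssocAlgCat R, ⟨Variety.algTerms _ _⟩⟩,
      ideallyExact_nonAssocAlgCat R, fun _ => not_hasZeroObject_nonAssocAlgCat R⟩,
    fun V => Variety.nonempty_terms_zero_iff,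
    ⟨_, Variety.trivialVariety_atMostOneElement, Variety.trivialVariety_containsEmpty⟩,
    ⟨_, Variety.trivialPointedVariety_atMostOneElement,
      Variety.trivialPointedVariety_not_containsEmpty⟩,
    fun V W => Variety.nonempty_equivalence_iff,
    fun V hV => ⟨hV.bournProtomodular, Variety.ideallyExact_iff.trans
      (and_iff_right hV.bournProtomodular)⟩,
    fun P _ => ⟨fun ⟨_, ha⟩ => barrExact_of_isTop ha, bournProtomodular_lattice,
      ideallyExact_lattice_iff⟩⟩
  · rintro V (⟨⟨T⟩⟩ | ⟨⟨T⟩⟩)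
    · exact ⟨⟨T.protomodularTerms⟩, T.protomodularTerms.ideallyExact⟩
    · exact ⟨⟨T.protomodularTerms⟩, T.protomodularTerms.ideallyExact⟩
  · have hz := Variety.hasZeroObject_of_isGroupsWithMultipleOperators hV
    obtain ⟨G, _⟩ := hV
    exact ⟨⟨G.protomodularTerms⟩, hz, G.protomodularTerms.semiAbelian_iff.1 hz,
      G.protomodularTerms.ideallyExact⟩
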